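/- A real algebraic integer $\lambda>1$ is a Salem number if its Galois conjugates off the unit circle are precisely $\lambda$ and $\lambda^{-1}$ (degree $2$ is allowed). Identify $\mathrm{Isom}(\mathbb{H}^2)$ with the group $\mathrm{O}^+(1,2)$ of linear isometries of $x_0^2-x_1^2-x_2^2$ that preserve the hyperboloid $\mathbb{H}^2=\{x_0^2-x_1^2-x_2^2=1,\ x_0>0\}$. A subgroup $\Gamma<\mathrm{Isom}(\mathbb{H}^2)$ is arithmetic, and $\Gamma\backslash\mathbb{H}^2$ is an arithmetic hyperbolic $2$-orbifold, if there are a totally real number field $K\subset\mathbb{R}$ and a ternary quadratic form $q$ over $K$ which has signature $(1,2)$ over $\mathbb{R}$, and is definite under every embedding $K\to\mathbb{R}$ other than the inclusion, such that $\Gamma$ is commensurable with $\mathrm{SO}_q(\mathcal{O}_K)$, up to conjugation in $\mathrm{Isom}(\mathbb{H}^2)$ (here $\mathrm{SO}_q(\mathcal{O}_K)$ is carried into $\mathrm{O}(1,2)$ by a real equivalence between $q$ and $x_0^2-x_1^2-x_2^2$, and its elements that preserve $\mathbb{H}^2$ are taken). The orbifold $\Gamma\backslash\mathbb{H}^2$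 realizes $\lambda$ if there is a loxodromic $\gamma\in\Gamma$ with $\lambda=e^{\ell(\gamma)}$, where $\ell(\gamma)=\inf_{x\in\mathbb{H}^2}d(\gamma x,x)$ is the translation length. **Proposition.** There is no arithmetic hyperbolic $2$-orbifold which realizes all Salem numbers of degree $2$. -/

import Mathlib

open scoped Matrix NumberField

noncomputable section

/-- A Salem number: a real algebraic integer `x > 1` whose Galois conjugates off the unit circle
are precisely `x` and `x⁻¹`. Degree two is allowed. -/
def IsSalem (x : ℝ) : Prop :=
  IsIntegral ℤ x ∧ 1 < x ∧
    {z : ℂ | Polynomial.aeval z (minpoly ℚ x) = 0 ∧ ‖z‖ ≠ 1} = {(x : ℂ), (x : ℂ)⁻¹}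

namespace Hyperbolic

/-- The diagonal matrix `J = diag(1, -1, …, -1)` of size `n + 1`. -/
def J (n : ℕ) : Matrix (Fin (n + 1)) (Fin (n + 1)) ℝ :=
  Matrix.diagonal fun i => if i = 0 then 1 else -1

/-- The Lorentzian bilinear form `x₀ y₀ - x₁ y₁ - ⋯ - xₙ yₙ`. -/
def form {n : ℕ} (x y : Fin (n + 1) → ℝ) : ℝ :=
  x 0 * y 0 - ∑ i : Fin n, x i.succ * y i.succ

/-- The hyperboloid model of hyperbolic `n`-space. -/
def Space (n : ℕ) : Set (Fin (n + 1) → ℝ) :=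
  {x | form x x = 1 ∧ 0 < x 0}

/-- The hyperbolic distance on the hyperboloid: `cosh d(x, y) = x₀ y₀ - x₁ y₁ - ⋯ - xₙ yₙ`. -/
def hdist {n : ℕ} (x y : Fin (n + 1) → ℝ) : ℝ :=
  Real.arcosh (form x y)

/-- The boundary at infinity: every ray of the future light cone contains exactly one vector
with `u₀ = 1`, which represents it here. -/
def Boundary (n : ℕ) : Set (Fin (n + 1) → ℝ) :=
  {u | form u u = 0 ∧ u 0 = 1}

/-- The isometry group of hyperbolic `n`-space, as the group `O⁺(1, n)` of all `A` with
`Aᵀ J A = J` that preserve the hyperboloid. -/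
def Isom (n : ℕ) : Subgroup (GL (Fin (n + 1)) ℝ) where
  carrier := {A | (A : Matrix (Fin (n + 1)) (Fin (n + 1)) ℝ)ᵀ * J n * A = J n ∧
    ∀ x, (A : Matrix (Fin (n + 1)) (Fin (n + 1)) ℝ) *ᵥ x ∈ Space n ↔ x ∈ Space n}
  one_mem' := by simp
  mul_mem' := by
    rintro A B ⟨hA, hA'⟩ ⟨hB, hB'⟩
    refine ⟨?_, fun x => ?_⟩
    · rw [Units.val_mul, Matrix.transpose_mul]
      calc _ = (B : Matrix (Fin (n + 1)) (Fin (n + 1)) ℝ)ᵀ *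
            ((A : Matrix (Fin (n + 1)) (Fin (n + 1)) ℝ)ᵀ * J n * A) * B := by
              simp only [Matrix.mul_assoc]
        _ = _ := by rw [hA, hB]
    · rw [Units.val_mul, ← Matrix.mulVec_mulVec, hA', hB']
  inv_mem' := by
    rintro A ⟨hA, hA'⟩
    have h1 : (A : Matrix (Fin (n + 1)) (Fin (n + 1)) ℝ) *
        ((A⁻¹ : GL (Fin (n + 1)) ℝ) : Matrix (Fin (n + 1)) (Fin (n + 1)) ℝ) = 1 := by
      rw [← Units.val_mul, mul_inv_cancel, Units.val_one]
    refine ⟨?_, fun x => ?_⟩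
    · conv_lhs => rw [← hA]
      calc _ = ((A : Matrix (Fin (n + 1)) (Fin (n + 1)) ℝ) *
              ((A⁻¹ : GL (Fin (n + 1)) ℝ) : Matrix (Fin (n + 1)) (Fin (n + 1)) ℝ))ᵀ * J n *
            ((A : Matrix (Fin (n + 1)) (Fin (n + 1)) ℝ) *
              ((A⁻¹ : GL (Fin (n + 1)) ℝ) : Matrix (Fin (n + 1)) (Fin (n + 1)) ℝ)) := by
              simp only [Matrix.mul_assoc, Matrix.transpose_mul]
        _ = _ := by rw [h1]; simp
    · rw [← hA', Matrix.mulVec_mulVec, h1, Matrix.one_mulVec]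

/-- The action of an isometry on vectors of `ℝⁿ⁺¹`, in particular on points of the hyperboloid. -/
def act {n : ℕ} (g : Isom n) (x : Fin (n + 1) → ℝ) : Fin (n + 1) → ℝ :=
  ((g : GL (Fin (n + 1)) ℝ) : Matrix (Fin (n + 1)) (Fin (n + 1)) ℝ) *ᵥ x

/-- An isometry is loxodromic if it has no fixed point in hyperbolic space and exactly two fixed
points in the boundary. A boundary point is fixed when its ray is mapped to itself. -/
def IsLoxodromic {n : ℕ} (g : Isom n) : Prop :=
  (∀ x ∈ Space n, act g x ≠ x) ∧
    {u | u ∈ Boundary n ∧ ∃ c : ℝ, act g u = c • u}.ncard = 2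

/-- The translation length `inf_x d(g x, x)`. -/
def translationLength {n : ℕ} (g : Isom n) : ℝ :=
  ⨅ x : Space n, hdist (act g x) x

/-- A group `Γ` of isometries (equivalently, the orbifold `Γ \ ℍⁿ`, when `Γ` is discrete)
realizes `x` if `x = exp ℓ(g)` for some loxodromic `g ∈ Γ`. -/
def Realizes {n : ℕ} (Γ : Subgroup (Isom n)) (x : ℝ) : Prop :=
  ∃ g ∈ Γ, IsLoxodromic g ∧ x = Real.exp (translationLength g)

/-- Two subgroups are commensurable in the wide sense: after conjugating the first by an isometry,
their intersection has finite index in both. -/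
def AreCommensurable {n : ℕ} (Γ₁ Γ₂ : Subgroup (Isom n)) : Prop :=
  ∃ g : Isom n, Subgroup.Commensurable (Γ₁.map (MulAut.conj g).toMonoidHom) Γ₂

section Arithmetic

variable {K : Type*} [Field K] {n : ℕ}

/-- A quadratic form `q(v) = vᵀ S v` over the field `K`, given by its symmetric matrix `S`, is
admissible with respect to the embedding `ι : K → ℝ` if it has signature `(1, n)` over `ℝ` via `ι`
and is (positive or negative) definite via every other embedding. -/
def IsAdmissible (ι : K →+* ℝ) (S : Matrix (Fin (n + 1)) (Fin (n + 1)) K) : Prop :=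
  S.IsSymm ∧
    (∃ M : GL (Fin (n + 1)) ℝ,
      (M : Matrix (Fin (n + 1)) (Fin (n + 1)) ℝ)ᵀ * J n * M = S.map ι) ∧
    ∀ σ : K →+* ℝ, σ ≠ ι → (S.map σ).PosDef ∨ (-S.map σ).PosDef

/-- The group `SO_q(𝓞_K)` of integral matrices of determinant one preserving `q(v) = vᵀ S v`. -/
def integralSO (S : Matrix (Fin (n + 1)) (Fin (n + 1)) K) :
    Subgroup (Matrix.SpecialLinearGroup (Fin (n + 1)) (𝓞 K)) where
  carrier := {A | (A.1.map (algebraMap (𝓞 K) K))ᵀ * S * A.1.map (algebraMap (𝓞 K) K) = S}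
  one_mem' := by simp
  mul_mem' := by
    intro A B hA hB
    simp only [Set.mem_ofPred_eq, Matrix.SpecialLinearGroup.coe_mul, Matrix.map_mul,
      Matrix.transpose_mul] at *
    calc _ = (B.1.map (algebraMap (𝓞 K) K))ᵀ * ((A.1.map (algebraMap (𝓞 K) K))ᵀ * S *
            A.1.map (algebraMap (𝓞 K) K)) * B.1.map (algebraMap (𝓞 K) K) := by
              simp only [Matrix.mul_assoc]
      _ = _ := by rw [hA, hB]
  inv_mem' := by
    intro A hA
    simp only [Set.mem_ofPred_eq] at *
    have h1 : A.1.map (algebraMap (𝓞 K) K) * (A⁻¹).1.map (algebraMap (𝓞 K) K) = 1 := by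
      rw [← Matrix.map_mul, ← Matrix.SpecialLinearGroup.coe_mul, mul_inv_cancel]
      simp
    conv_lhs => rw [← hA]
    calc _ = (A.1.map (algebraMap (𝓞 K) K) * (A⁻¹).1.map (algebraMap (𝓞 K) K))ᵀ * S *
          (A.1.map (algebraMap (𝓞 K) K) * (A⁻¹).1.map (algebraMap (𝓞 K) K)) := by
            simp only [Matrix.mul_assoc, Matrix.transpose_mul]
      _ = _ := by rw [h1]; simp

/-- The subgroup of `O⁺(1, n)` given by `SO_q(𝓞_K)`: if `Mᵀ J M` is the real matrix of `q`, then
`A ↦ M A M⁻¹` carries the real orthogonal group of `q` to that of `J`. Only the images that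
preserve the hyperboloid (a subgroup of index at most two) are kept. -/
def arithmeticGroup (ι : K →+* ℝ) (S : Matrix (Fin (n + 1)) (Fin (n + 1)) K)
    (M : GL (Fin (n + 1)) ℝ) : Subgroup (Isom n) :=
  ((integralSO S).map ((MulAut.conj M).toMonoidHom.comp
    (Matrix.SpecialLinearGroup.toGL.comp
      (Matrix.SpecialLinearGroup.map (ι.comp (algebraMap (𝓞 K) K)))))).subgroupOf (Isom n)

/-- `Γ` is an arithmetic subgroup (of the first type) of the isometry group, defined over `K`,
where `K` is regarded as a subfield of `ℝ` through `ι`: it is commensurable with `SO_q(𝓞_K)` for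
some admissible `q` of rank `n + 1` over `K`. -/
def IsArithmetic (ι : K →+* ℝ) (Γ : Subgroup (Isom n)) : Prop :=
  ∃ (S : Matrix (Fin (n + 1)) (Fin (n + 1)) K) (M : GL (Fin (n + 1)) ℝ),
    IsAdmissible ι S ∧
    (M : Matrix (Fin (n + 1)) (Fin (n + 1)) ℝ)ᵀ * J n * M = S.map ι ∧
    AreCommensurable Γ (arithmeticGroup ι S M)

end Arithmetic

end Hyperbolic

end

/-!
Suppose that an arithmetic group `Γ` realizes every quadratic unit `x > 1` with `x + x⁻¹ = a` an
integer `a ≥ 3`.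

A loxodromic element `γ` has eigenvalues `x`, `x⁻¹` and `det γ = ±1`, where `x = exp ℓ(γ)`
(`Hyperbolic.trace_pow_of_isLoxodromic`). Some power `γ ^ k` lies in the arithmetic group, and its
trace `x ^ k + x⁻¹ ^ k + 1` is an integer greater than `3`. This trace does not change under another
real embedding of `K`, but there the form is definite and traces are at most `3`. So `K = ℚ`, and
`Γ` has a normal subgroup `N` of finite index which consists of integral isometries of an integral
ternary form `S`.

The elements of `Γ` have bounded denominators. An integral rotation `A` has an integral axis, the
axial vector `Ternary.axis S A` of the antisymmetric matrix `S A - (S A)ᵀ`, and `γ` maps the axis of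
`A` to that of `γ A γ⁻¹`, up to sign. Hence `Γ` preserves, up to sign, the lattice spanned by the
axes of the elements of `N`, and it is enough that three of these axes are independent. If `A₁` and
`A₂` are powers of elements which realize `a = 3` and `a = 4`, then the axes of `A₁`, `A₂` and
`A₁ A₂ A₁⁻¹` are: by `Ternary.two_mul_det_mul_axis_triple` their determinant is, up to a nonzero
factor, `q(b₁) q(b₂) - B(b₁, b₂)²`, where `q` and `B` are the forms of `S`, and `q(b₁) q(b₂)` is `15`
times a nonzero square. So there is an integer `D ≠ 0` with `D γ` integral for all `γ` in `Γ`
(`Ternary.exists_denominator`).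

Finally, the spinor norm of `det γ • γ` is represented by `2 + det γ * a`. At an odd prime `p` that
divides neither `D` nor `det S`, spinor norms are units up to squares. The elementary form of this
fact that is needed is `Ternary.sq_dvd_of_dvd`: such a prime cannot divide `2 + det γ * a` exactly
once. But there are `a` for which `a + 2` and `a - 2` are each divisible exactly once by some
arbitrarily large prime.
-/

open scoped Matrix NumberField

noncomputable section

/-! ### Rotations of ternary quadratic forms and their axes -/

namespace Ternary

open Matrix

variable {R : Type*} [CommRing R]

/-- The Cayley–Hamilton theorem in size three, solved for the adjugate. -/
theorem adjugate_eq_sq_sub (A : Matrix (Fin 3) (Fin 3) R) :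
    A.adjugate = A * A - A.trace • A + A.adjugate.trace • (1 : Matrix (Fin 3) (Fin 3) R) := by
  rw [adjugate_fin_three]
  ext i j
  fin_cases i <;> fin_cases j <;>
    simp [trace_fin_three, mul_apply, Fin.sum_univ_three] <;> ring

theorem two_mul_trace_adjugate (A : Matrix (Fin 3) (Fin 3) R) :
    2 * A.adjugate.trace = A.trace ^ 2 - (A * A).trace := by
  rw [adjugate_fin_three]
  simp [trace_fin_three, mul_apply, Fin.sum_univ_three]
  ring

theorem det_add_one (A : Matrix (Fin 3) (Fin 3) R) :
    (A + 1).det = 1 + A.trace + A.adjugate.trace + A.det := by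
  rw [adjugate_fin_three]
  simp [trace_fin_three, det_fin_three]
  ring

theorem dotProduct_transpose_mulVec (A : Matrix (Fin 3) (Fin 3) R) (x y : Fin 3 → R) :
    x ⬝ᵥ (Aᵀ *ᵥ y) = (A *ᵥ x) ⬝ᵥ y := by
  rw [dotProduct_mulVec, vecMul_transpose]

/-- The matrix of the cross product `y ↦ b × y`. -/
def skew (b : Fin 3 → R) : Matrix (Fin 3) (Fin 3) R :=
  !![0, -b 2, b 1; b 2, 0, -b 0; -b 1, b 0, 0]

theorem skew_injective : Function.Injective (skew (R := R)) := by
  intro b c h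
  ext i
  fin_cases i
  · simpa [skew] using congrFun₂ h 2 1
  · simpa [skew] using congrFun₂ h 0 2
  · simpa [skew] using congrFun₂ h 1 0

theorem smul_skew (c : R) (b : Fin 3 → R) : c • skew b = skew (c • b) := by
  ext i j
  fin_cases i <;> fin_cases j <;> simp [skew]

theorem adjugate_skew (b : Fin 3 → R) : (skew b).adjugate = vecMulVec b b := by
  rw [skew, adjugate_fin_three_of]
  ext i j
  fin_cases i <;> fin_cases j <;> simp [vecMulVec_apply] <;> ring

/-- The cross product is natural up to the determinant:
`Y x · (Y b × Y y) = det Y (x · (b × y))`. -/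
theorem transpose_mul_skew_mul (Y : Matrix (Fin 3) (Fin 3) R) (b : Fin 3 → R) :
    Yᵀ * skew (Y *ᵥ b) * Y = Y.det • skew b := by
  ext i j
  fin_cases i <;> fin_cases j <;>
    simp [skew, mul_apply, Fin.sum_univ_three, det_fin_three, mulVec, dotProduct] <;> ring

/-- The axial vector of the antisymmetric matrix `S A - (S A)ᵀ`. For `A` in the special orthogonal
group of `S` it is fixed by `A`, and so it spans the axis of `A` unless it vanishes. -/
def axis (S A : Matrix (Fin 3) (Fin 3) R) : Fin 3 → R :=
  ![(S * A) 2 1 - (S * A) 1 2, (S * A) 0 2 - (S * A) 2 0, (S * A) 1 0 - (S * A) 0 1]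

theorem skew_axis (S A : Matrix (Fin 3) (Fin 3) R) : skew (axis S A) = S * A - (S * A)ᵀ := by
  ext i j
  fin_cases i <;> fin_cases j <;> simp [skew, axis, -transpose_mul]

theorem map_axis {T : Type*} [CommRing T] (f : R →+* T) (S A : Matrix (Fin 3) (Fin 3) R) :
    axis (S.map f) (A.map f) = f ∘ axis S A := by
  ext i
  fin_cases i <;> simp [axis, ← Matrix.map_mul]

/-- Conjugation by an isometry `Y` of `S` transports axes by `Y`, up to the sign `det Y`. -/
theorem det_smul_axis_conj {S Y Y' : Matrix (Fin 3) (Fin 3) R} (A : Matrix (Fin 3) (Fin 3) R)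
    (hY : Yᵀ * S * Y = S) (h : Y * Y' = 1) :
    Y.det • axis S (Y * A * Y') = Y *ᵥ axis S A := by
  have h' : Y' * Y = 1 := mul_eq_one_comm.mp h
  have e1 : Yᵀ * skew (axis S (Y * A * Y')) * Y = skew (axis S A) := by
    have e : Yᵀ * (S * (Y * A * Y')) * Y = S * A := by
      calc _ = (Yᵀ * S * Y) * A * (Y' * Y) := by simp only [Matrix.mul_assoc]
        _ = _ := by rw [hY, h', Matrix.mul_one]
    have e' : Yᵀ * (S * (Y * A * Y'))ᵀ * Y = (S * A)ᵀ := by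
      rw [← e]; simp only [transpose_mul, transpose_transpose, Matrix.mul_assoc]
    rw [skew_axis, skew_axis, Matrix.mul_sub, Matrix.sub_mul, e, e']
  have e2 := transpose_mul_skew_mul Y (axis S A)
  rw [← e1] at e2
  have h't : Y'ᵀ * Yᵀ = 1 := by rw [← transpose_mul, h, transpose_one]
  have cancel : ∀ X : Matrix (Fin 3) (Fin 3) R, Y'ᵀ * (Yᵀ * X * Y) * Y' = X := by
    intro X
    calc _ = (Y'ᵀ * Yᵀ) * X * (Y * Y') := by simp only [Matrix.mul_assoc]
      _ = _ := by rw [h't, h, Matrix.one_mul, Matrix.mul_one]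
  apply skew_injective
  rw [← smul_skew, ← cancel (skew (Y *ᵥ axis S A)), e2, mul_smul_comm, smul_mul_assoc, cancel]

section SpecialOrthogonal

variable {S A : Matrix (Fin 3) (Fin 3) R} {a : R}

theorem mul_adjugate_eq_transpose_mul (hA : Aᵀ * S * A = S) (hd : A.det = 1) :
    S * A.adjugate = Aᵀ * S := by
  conv_lhs => rw [← hA, Matrix.mul_assoc, mul_adjugate, hd, one_smul, Matrix.mul_one]

variable [IsDomain R]

theorem trace_adjugate (hA : Aᵀ * S * A = S) (hd : A.det = 1) (hS : S.det ≠ 0) :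
    A.adjugate.trace = A.trace := by
  have h : S.det • A.adjugate = S.adjugate * (Aᵀ * S) := by
    rw [← mul_adjugate_eq_transpose_mul hA hd, ← Matrix.mul_assoc, adjugate_mul, smul_mul_assoc,
      Matrix.one_mul]
  have h2 := congrArg trace h
  rw [trace_smul, ← Matrix.mul_assoc, trace_mul_comm, ← Matrix.mul_assoc, mul_adjugate,
    smul_mul_assoc, Matrix.one_mul, trace_smul, trace_transpose] at h2
  exact mul_left_cancel₀ hS h2

theorem sq_eq (hA : Aᵀ * S * A = S) (hd : A.det = 1) (hS : S.det ≠ 0) (ht : A.trace = a + 1) :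
    A * A = (a + 1) • A - (a + 1) • (1 : Matrix (Fin 3) (Fin 3) R) + A.adjugate := by
  have h := adjugate_eq_sq_sub A
  rw [trace_adjugate hA hd hS, ht] at h
  rw [h]; abel

theorem adjugate_sq_eq (hA : Aᵀ * S * A = S) (hd : A.det = 1) (hS : S.det ≠ 0)
    (ht : A.trace = a + 1) : A.adjugate * A.adjugate =
      (a + 1) • A.adjugate - (a + 1) • (1 : Matrix (Fin 3) (Fin 3) R) + A := by
  have h := congrArg (· * A.adjugate * A.adjugate) (sq_eq hA hd hS ht)
  have h1 : A * A.adjugate = 1 := by rw [mul_adjugate, hd, one_smul]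
  have h2 : A.adjugate * A = 1 := by rw [adjugate_mul, hd, one_smul]
  have h3 := congrArg (· * A) h
  simp only [Matrix.mul_assoc, h1, h2, Matrix.mul_one, Matrix.add_mul, Matrix.sub_mul,
    smul_mul_assoc, Matrix.one_mul] at h3
  rw [eq_sub_of_add_eq' h3.symm]; abel

/-- Since `A⁻¹ = A.adjugate` has the same trace as `A`, the Cayley–Hamilton theorem expresses every
polynomial in `A` and `A⁻¹` through `A`, `A⁻¹` and `1`. -/
theorem adjugate_sub_adjugate (hA : Aᵀ * S * A = S) (hd : A.det = 1) (hS : S.det ≠ 0)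
    (h2 : (2 : R) ≠ 0) (ht : A.trace = a + 1) :
    (A - A.adjugate).adjugate =
      (a + 2) • (A + A.adjugate - a • (1 : Matrix (Fin 3) (Fin 3) R)) := by
  have ha : A * A.adjugate = 1 := by rw [mul_adjugate, hd, one_smul]
  have ha' : A.adjugate * A = 1 := by rw [adjugate_mul, hd, one_smul]
  have hsq : (A - A.adjugate) * (A - A.adjugate) =
      (a + 2) • (A + A.adjugate) - (2 * (a + 2)) • (1 : Matrix (Fin 3) (Fin 3) R) := by
    rw [Matrix.sub_mul, Matrix.mul_sub, Matrix.mul_sub, ha, ha', sq_eq hA hd hS ht,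
      adjugate_sq_eq hA hd hS ht]
    module
  have ht0 : (A - A.adjugate).trace = 0 := by
    rw [trace_sub, trace_adjugate hA hd hS, sub_self]
  have he : (A - A.adjugate).adjugate.trace = 4 - a ^ 2 := by
    apply mul_left_cancel₀ h2
    rw [two_mul_trace_adjugate, ht0, hsq]
    simp only [trace_sub, trace_add, trace_smul, trace_adjugate hA hd hS, ht, trace_one]
    simp
    ring
  rw [adjugate_eq_sq_sub (A - A.adjugate), he, ht0, hsq]
  module

/-- The axis of `A` as a rank one matrix. -/
theorem vecMulVec_axis (hA : Aᵀ * S * A = S) (hsymm : S.IsSymm) (hd : A.det = 1) (hS : S.det ≠ 0)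
    (h2 : (2 : R) ≠ 0) (ht : A.trace = a + 1) :
    vecMulVec (axis S A) (axis S A) =
      (a + 2) • ((A + A.adjugate - a • (1 : Matrix (Fin 3) (Fin 3) R)) * S.adjugate) := by
  rw [← adjugate_skew, skew_axis, transpose_mul, hsymm.eq, ← mul_adjugate_eq_transpose_mul hA hd,
    ← Matrix.mul_sub, adjugate_mul_distrib, adjugate_sub_adjugate hA hd hS h2 ht, smul_mul_assoc]

/-- The length of the axis of `A` is, up to the factor `-det S`, the discriminant `a² - 4` of the
nontrivial factor `X² - a X + 1` of the characteristic polynomial. -/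
theorem axis_dotProduct (hA : Aᵀ * S * A = S) (hsymm : S.IsSymm) (hd : A.det = 1)
    (hS : S.det ≠ 0) (h2 : (2 : R) ≠ 0) (ht : A.trace = a + 1) :
    axis S A ⬝ᵥ (S *ᵥ axis S A) = S.det * (4 - a ^ 2) := by
  have h : axis S A ⬝ᵥ (S *ᵥ axis S A) = (vecMulVec (axis S A) (axis S A) * S).trace := by
    rw [vecMulVec_mul, trace_vecMulVec, dotProduct_mulVec, dotProduct_comm]
  rw [h, vecMulVec_axis hA hsymm hd hS h2 ht, smul_mul_assoc, Matrix.mul_assoc, adjugate_mul,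
    trace_smul, mul_smul_comm, Matrix.mul_one, trace_smul]
  simp only [trace_sub, trace_add, trace_smul, trace_adjugate hA hd hS, ht, trace_one]
  simp
  ring

/-- The Gram determinant of the axis of `A` and a vector `v` computes the determinant of the three
vectors `axis S A`, `v`, `A v`. -/
theorem two_mul_det_mul_axis_triple (hA : Aᵀ * S * A = S) (hsymm : S.IsSymm) (hd : A.det = 1)
    (hS : S.det ≠ 0) (h2 : (2 : R) ≠ 0) (ht : A.trace = a + 1) (v : Fin 3 → R) :
    2 * S.det * ((A *ᵥ v) ⬝ᵥ (skew (axis S A) *ᵥ v)) =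
      (axis S A ⬝ᵥ (S *ᵥ axis S A)) * (v ⬝ᵥ (S *ᵥ v)) - (axis S A ⬝ᵥ (S *ᵥ v)) ^ 2 := by
  have hadj := mul_adjugate_eq_transpose_mul hA hd
  have hstar : ∀ X : Matrix (Fin 3) (Fin 3) R, v ⬝ᵥ (Xᵀ *ᵥ v) = v ⬝ᵥ (X *ᵥ v) := by
    intro X
    rw [dotProduct_transpose_mulVec, dotProduct_comm]
  -- the triple product is `q(v) - v · S A⁻² v`
  have e1 : 2 * ((A *ᵥ v) ⬝ᵥ (skew (axis S A) *ᵥ v)) =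
      v ⬝ᵥ ((2 • S - S * (A * A) - S * (A.adjugate * A.adjugate)) *ᵥ v) := by
    have t1 : (A *ᵥ v) ⬝ᵥ (skew (axis S A) *ᵥ v) =
        v ⬝ᵥ ((S - S * (A.adjugate * A.adjugate)) *ᵥ v) := by
      rw [← dotProduct_transpose_mulVec, mulVec_mulVec, skew_axis, transpose_mul, hsymm.eq,
        ← hadj, Matrix.mul_sub, ← Matrix.mul_assoc Aᵀ S A, hA, ← Matrix.mul_assoc Aᵀ, ← hadj,
        Matrix.mul_assoc S]
    have t2 : v ⬝ᵥ ((S * (A.adjugate * A.adjugate)) *ᵥ v) = v ⬝ᵥ ((S * (A * A)) *ᵥ v) := by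
      rw [← hstar (S * (A * A)), transpose_mul, transpose_mul, hsymm.eq, Matrix.mul_assoc, ← hadj,
        ← Matrix.mul_assoc, hadj, Matrix.mul_assoc, hadj]
    rw [t1]
    simp only [sub_mulVec, dotProduct_sub, t2, two_smul, add_mulVec, dotProduct_add]
    ring
  have e2 : (axis S A ⬝ᵥ (S *ᵥ v)) ^ 2 = (a + 2) * S.det *
      (v ⬝ᵥ ((S * A + S * A.adjugate) *ᵥ v) - a * (v ⬝ᵥ (S *ᵥ v))) := by
    have t : (axis S A ⬝ᵥ (S *ᵥ v)) ^ 2 =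
        v ⬝ᵥ ((S * vecMulVec (axis S A) (axis S A) * S) *ᵥ v) := by
      rw [← mulVec_mulVec, ← mulVec_mulVec, vecMulVec_mulVec, mulVec_smul, dotProduct_smul,
        dotProduct_mulVec v S, ← mulVec_transpose, hsymm.eq, dotProduct_comm (S *ᵥ v)]
      simp [sq]
    rw [t, vecMulVec_axis hA hsymm hd hS h2 ht, mul_smul_comm, smul_mul_assoc, Matrix.mul_assoc,
      Matrix.mul_assoc, adjugate_mul, mul_smul_comm, Matrix.mul_one, mul_smul_comm,
      Matrix.mul_sub, Matrix.mul_add, mul_smul_comm, Matrix.mul_one]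
    simp only [smul_mulVec, sub_mulVec, dotProduct_sub, dotProduct_smul, smul_eq_mul]
    ring
  rw [axis_dotProduct hA hsymm hd hS h2 ht, e2, mul_right_comm, e1, sq_eq hA hd hS ht,
    adjugate_sq_eq hA hd hS ht]
  simp only [Matrix.mul_add, Matrix.mul_sub, sub_mulVec, add_mulVec, dotProduct_sub,
    dotProduct_add, mul_smul_comm, Matrix.mul_one, smul_mulVec, dotProduct_smul, smul_eq_mul,
    two_smul]
  ring

/-- If `A` is an isometry of a form that is unimodular at the odd prime `p`, then `p` cannot divide
`a + 2`, which represents the spinor norm of `A`, exactly once. Indeed, if `p ∣ a + 2`, then the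
axis of `A` vanishes modulo `p`, because its entries have squares divisible by `a + 2`. So
`A ≡ A⁻¹` modulo `p`, and `p` divides the second factor of
`(A + 1) * ((a + 2) - (A - A⁻¹)) = 2 * (a + 2)`. Comparing determinants, with
`det (A + 1) = 2 * (a + 2)`, gives a second factor `p` of `a + 2`. -/
theorem sq_dvd_of_dvd {p : R} (hp : Prime p) (hA : Aᵀ * S * A = S) (hsymm : S.IsSymm)
    (hd : A.det = 1) (hpS : ¬ p ∣ S.det) (hp2 : ¬ p ∣ 2) (ht : A.trace = a + 1)
    (hpa : p ∣ a + 2) : p ^ 2 ∣ a + 2 := by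
  have hS : S.det ≠ 0 := fun h => hpS (h ▸ dvd_zero p)
  have h2 : (2 : R) ≠ 0 := fun h => hp2 (h ▸ dvd_zero p)
  obtain ⟨w, hw⟩ := hpa
  have hb : ∀ i, p ∣ axis S A i := by
    intro i
    have h := congrFun₂ (vecMulVec_axis hA hsymm hd hS h2 ht) i i
    rw [vecMulVec_apply, Matrix.smul_apply, smul_eq_mul, hw, mul_assoc] at h
    exact (or_self_iff.mp (hp.dvd_or_dvd (Dvd.intro _ h.symm)))
  choose c hc using hb
  have hcc : axis S A = p • c := funext hc
  have hX : ∀ i j, p ∣ (A - A.adjugate) i j := by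
    intro i j
    have h : S.det • (A - A.adjugate) = p • (S.adjugate * skew c) := by
      rw [← mul_smul_comm, smul_skew, ← hcc, skew_axis, transpose_mul, hsymm.eq,
        ← mul_adjugate_eq_transpose_mul hA hd, ← Matrix.mul_sub, ← Matrix.mul_assoc, adjugate_mul,
        smul_mul_assoc, Matrix.one_mul]
    have h' := congrFun₂ h i j
    simp only [Matrix.smul_apply, smul_eq_mul] at h'
    exact (hp.dvd_or_dvd (Dvd.intro _ h'.symm)).resolve_left hpS
  choose X hX using hX
  have hXX : A - A.adjugate = p • (Matrix.of X) := by ext i j; exact hX i j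
  have hprod : (A + 1) * ((a + 2) • (1 : Matrix (Fin 3) (Fin 3) R) - (A - A.adjugate)) =
      (2 * (a + 2)) • (1 : Matrix (Fin 3) (Fin 3) R) := by
    have h1 : A * A.adjugate = 1 := by rw [mul_adjugate, hd, one_smul]
    simp only [Matrix.add_mul, Matrix.mul_sub, mul_smul_comm, Matrix.mul_one, Matrix.one_mul, h1,
      sq_eq hA hd hS ht]
    module
  have hdet := congrArg det hprod
  rw [hXX, hw, mul_smul, ← smul_sub, det_mul, det_add_one, trace_adjugate hA hd hS, hd, ht,
    det_smul, det_smul, det_one, Fintype.card_fin] at hdet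
  -- it remains to see that `p` divides `w`, where `a + 2 = p * w`
  rw [hw, sq]
  refine mul_dvd_mul_left p ?_
  have h3 : p ^ 3 * (w * (p * (w • (1 : Matrix (Fin 3) (Fin 3) R) - Matrix.of X).det)) =
      p ^ 3 * (w * (2 * 2 * w * w)) := by
    apply mul_left_cancel₀ h2
    linear_combination hdet -
      2 * p ^ 3 * (w • (1 : Matrix (Fin 3) (Fin 3) R) - Matrix.of X).det * hw
  have h4 := mul_left_cancel₀ (pow_ne_zero 3 hp.ne_zero) h3
  by_cases hw0 : w = 0
  · simp [hw0]
  have h5 := mul_left_cancel₀ hw0 h4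
  rcases hp.dvd_or_dvd (Dvd.intro _ h5) with h | h
  · rcases hp.dvd_or_dvd h with h | h
    · exact absurd ((hp.dvd_or_dvd h).elim id id) hp2
    · exact h
  · exact h

end SpecialOrthogonal

end Ternary

/-! ### Loxodromic isometries of the hyperbolic plane -/

namespace Hyperbolic

open Matrix

theorem form_two (x y : Fin 3 → ℝ) : form x y = x 0 * y 0 - x 1 * y 1 - x 2 * y 2 := by
  simp [form, Fin.sum_univ_two]; ring

theorem form_eq_dotProduct (x y : Fin 3 → ℝ) : form x y = x ⬝ᵥ (J 2 *ᵥ y) := by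
  rw [form_two]
  simp [J, dotProduct, mulVec_diagonal, Fin.sum_univ_three]
  ring

theorem form_act (g : Isom 2) (x y : Fin 3 → ℝ) : form (act g x) (act g y) = form x y := by
  rw [form_eq_dotProduct, form_eq_dotProduct, act, act,
    ← Ternary.dotProduct_transpose_mulVec, mulVec_mulVec, mulVec_mulVec, g.2.1]

theorem det_isom_sq (g : Isom 2) : ((g : GL (Fin 3) ℝ) : Matrix (Fin 3) (Fin 3) ℝ).det ^ 2 = 1 := by
  have h := congrArg det g.2.1
  have hJ : (J 2).det = 1 := by simp [J, Fin.prod_univ_three]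
  rw [det_mul, det_mul, det_transpose, hJ] at h
  linear_combination h

/-- The Lorentzian cross product, orthogonal to both factors. -/
def lcross (u v : Fin 3 → ℝ) : Fin 3 → ℝ :=
  ![u 1 * v 2 - u 2 * v 1, u 0 * v 2 - u 2 * v 0, u 1 * v 0 - u 0 * v 1]

theorem lcross_eq (u v : Fin 3 → ℝ) : lcross u v = J 2 *ᵥ (Ternary.skew u *ᵥ v) := by
  ext i
  fin_cases i <;>
    simp [lcross, J, Ternary.skew, mulVec, dotProduct, Fin.sum_univ_three] <;>
    ring

/-- Isometries commute with the Lorentzian cross product, up to the determinant. In particular, the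
cross product of two null eigenvectors of `g` is a third eigenvector. -/
theorem act_lcross (g : Isom 2) (u v : Fin 3 → ℝ) :
    act g (lcross u v) =
      ((g : GL (Fin 3) ℝ) : Matrix (Fin 3) (Fin 3) ℝ).det • lcross (act g u) (act g v) := by
  have hJJ : J 2 * J 2 = 1 := by
    ext i j
    fin_cases i <;> fin_cases j <;> simp [J]
  have hg := g.2.1
  have hd := det_isom_sq g
  rw [lcross_eq, lcross_eq, act, act, act]
  generalize ((g : GL (Fin 3) ℝ) : Matrix (Fin 3) (Fin 3) ℝ) = A at hg hd ⊢
  have h := Ternary.transpose_mul_skew_mul A u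
  have h1 : (A * J 2) * (Aᵀ * J 2) = 1 := by
    rw [mul_eq_one_comm]
    calc _ = (Aᵀ * J 2 * A) * J 2 := by simp only [Matrix.mul_assoc]
      _ = 1 := by rw [hg, hJJ]
  have h2 : A * J 2 * Aᵀ = J 2 := by
    calc _ = (A * J 2) * (Aᵀ * J 2) * J 2 := by
            rw [Matrix.mul_assoc, Matrix.mul_assoc, Matrix.mul_assoc, Matrix.mul_assoc, hJJ,
              Matrix.mul_one]
      _ = _ := by rw [h1, Matrix.one_mul]
  have h3 : J 2 * Ternary.skew (A *ᵥ u) * A = A.det • (A * J 2 * Ternary.skew u) := by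
    calc _ = (A * J 2 * Aᵀ) * Ternary.skew (A *ᵥ u) * A := by rw [h2]
      _ = A * J 2 * (Aᵀ * Ternary.skew (A *ᵥ u) * A) := by simp only [Matrix.mul_assoc]
      _ = _ := by rw [h, mul_smul_comm]
  rw [mulVec_mulVec, mulVec_mulVec, mulVec_mulVec, mulVec_mulVec, h3, smul_mulVec, smul_smul, ← sq,
    hd, one_smul, Matrix.mul_assoc]

theorem form_pos {u v : Fin 3 → ℝ} (hu : u ∈ Boundary 2) (hv : v ∈ Boundary 2) (h : u ≠ v) :
    0 < form u v := by
  obtain ⟨hu1, hu0⟩ := hu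
  obtain ⟨hv1, hv0⟩ := hv
  rw [form_two, hu0] at hu1
  rw [form_two, hv0] at hv1
  rw [form_two, hu0, hv0]
  by_contra! hle
  have h1 : (u 1 - v 1) ^ 2 + (u 2 - v 2) ^ 2 ≤ 0 := by nlinarith
  have h2 : u 1 - v 1 = 0 := by nlinarith [sq_nonneg (u 1 - v 1), sq_nonneg (u 2 - v 2)]
  have h3 : u 2 - v 2 = 0 := by nlinarith [sq_nonneg (u 1 - v 1), sq_nonneg (u 2 - v 2)]
  apply h
  ext i
  fin_cases i
  · exact hu0.trans hv0.symm
  · exact sub_eq_zero.mp h2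
  · exact sub_eq_zero.mp h3

theorem form_pos_of_mem_space {x u : Fin 3 → ℝ} (hx : x ∈ Space 2) (hu : u ∈ Boundary 2) :
    0 < form x u := by
  obtain ⟨hu1, hu0⟩ := hu
  obtain ⟨hx1, hx0⟩ := hx
  rw [form_two, hu0] at hu1
  rw [form_two] at hx1
  rw [form_two, hu0]
  have h : (x 1 * u 1 + x 2 * u 2) ^ 2 < x 0 ^ 2 := by
    nlinarith [sq_nonneg (x 1 * u 2 - x 2 * u 1)]
  have := abs_lt_of_sq_lt_sq h hx0.le
  have := (abs_lt.mp this).2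
  linarith

/-- The eigenvalue of an isometry at a fixed boundary point is positive. -/
theorem pos_of_act_eq_smul {g : Isom 2} {u : Fin 3 → ℝ} (hu : u ∈ Boundary 2) {c : ℝ}
    (h : act g u = c • u) : 0 < c := by
  have ho : (![1, 0, 0] : Fin 3 → ℝ) ∈ Space 2 := by constructor <;> simp [form_two]
  have h1 := form_pos_of_mem_space ho hu
  have h2 := form_pos_of_mem_space ((g.2.2 _).mpr ho) hu
  have h3 := form_act g ![1, 0, 0] u
  rw [h] at h3
  have h4 : form (act g ![1, 0, 0]) (c • u) = c * form (act g ![1, 0, 0]) u := by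
    simp only [form_two, Pi.smul_apply, smul_eq_mul]; ring
  rw [← h3, h4] at h1
  exact pos_of_mul_pos_left h1 h2.le

/-- The matrix with columns `u`, `v` and their Lorentzian cross product. -/
def frame (u v : Fin 3 → ℝ) : Matrix (Fin 3) (Fin 3) ℝ :=
  (Matrix.of ![u, v, lcross u v])ᵀ

theorem frame_mulVec (u v y : Fin 3 → ℝ) :
    frame u v *ᵥ y = y 0 • u + y 1 • v + y 2 • lcross u v := by
  ext i
  simp [frame, mulVec, dotProduct, Fin.sum_univ_three]
  ring

theorem det_frame {u v : Fin 3 → ℝ} (hu : u ∈ Boundary 2) (hv : v ∈ Boundary 2) :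
    (frame u v).det = - form u v ^ 2 := by
  obtain ⟨hu1, hu0⟩ := hu
  obtain ⟨hv1, hv0⟩ := hv
  rw [form_two, hu0] at hu1
  rw [form_two, hv0] at hv1
  rw [frame, det_transpose, form_two]
  simp [det_fin_three, lcross, hu0, hv0]
  linear_combination (v 1 ^ 2 + v 2 ^ 2 - 1) * hu1 + (2 - 2 * (u 1 ^ 2 + u 2 ^ 2)) * hv1

/-- In the frame of two boundary points the form is `2 F y₀ y₁ - F² y₂²`, where `F` is the product
of the two points. -/
theorem form_frame {u v : Fin 3 → ℝ} (hu : u ∈ Boundary 2) (hv : v ∈ Boundary 2)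
    (y z : Fin 3 → ℝ) : form (frame u v *ᵥ y) (frame u v *ᵥ z) =
      form u v * (y 0 * z 1 + y 1 * z 0) - form u v ^ 2 * (y 2 * z 2) := by
  obtain ⟨hu1, hu0⟩ := hu
  obtain ⟨hv1, hv0⟩ := hv
  rw [form_two, hu0] at hu1
  rw [form_two, hv0] at hv1
  rw [frame_mulVec, frame_mulVec, form_two, form_two]
  simp [lcross, hu0, hv0]
  linear_combination (y 0 * z 0 + (v 1 ^ 2 + v 2 ^ 2 - 1) * y 2 * z 2) * hu1 +
    (y 1 * z 1 + 2 * y 2 * z 2 - 2 * (u 1 ^ 2 + u 2 ^ 2) * y 2 * z 2) * hv1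

/-- An isometry fixing two boundary points is diagonal in their frame. -/
theorem isom_mul_frame (g : Isom 2) {u v : Fin 3 → ℝ} {c d : ℝ} (hc : act g u = c • u)
    (hd : act g v = d • v) (hcd : c * d = 1) :
    ((g : GL (Fin 3) ℝ) : Matrix (Fin 3) (Fin 3) ℝ) * frame u v =
      frame u v * diagonal ![c, d, ((g : GL (Fin 3) ℝ) : Matrix (Fin 3) (Fin 3) ℝ).det] := by
  have hw : act g (lcross u v) =
      ((g : GL (Fin 3) ℝ) : Matrix (Fin 3) (Fin 3) ℝ).det • lcross u v := by
    rw [act_lcross, hc, hd]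
    congr 1
    ext i
    fin_cases i <;> simp [lcross]
    · linear_combination (u 1 * v 2 - u 2 * v 1) * hcd
    · linear_combination (u 0 * v 2 - u 2 * v 0) * hcd
    · linear_combination (u 1 * v 0 - u 0 * v 1) * hcd
  have key : ∀ y, ((g : GL (Fin 3) ℝ) : Matrix (Fin 3) (Fin 3) ℝ) *ᵥ (frame u v *ᵥ y) =
      frame u v *ᵥ
        (diagonal ![c, d, ((g : GL (Fin 3) ℝ) : Matrix (Fin 3) (Fin 3) ℝ).det] *ᵥ y) := by
    intro y
    unfold act at hc hd hw
    rw [frame_mulVec, frame_mulVec, mulVec_add, mulVec_add, mulVec_smul, mulVec_smul, mulVec_smul,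
      hc, hd, hw]
    simp [mulVec_diagonal, smul_smul, mul_comm]
  apply mulVec_injective
  funext y
  rw [← mulVec_mulVec, ← mulVec_mulVec, key]

/-- The infimum defining the translation length is attained on the geodesic joining the two fixed
boundary points. -/
theorem translationLength_eq {g : Isom 2} {u v : Fin 3 → ℝ} (hu : u ∈ Boundary 2)
    (hv : v ∈ Boundary 2) (huv : u ≠ v) {c d : ℝ} (hc : act g u = c • u)
    (hd : act g v = d • v) (hcd : c * d = 1) :
    translationLength g = Real.arcosh ((c + d) / 2) := by
  have hF := form_pos hu hv huv
  have hc0 := pos_of_act_eq_smul hu hc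
  have hd0 := pos_of_act_eq_smul hv hd
  have hcd2 : 1 ≤ (c + d) / 2 := by nlinarith [sq_nonneg (c - d)]
  have he := det_isom_sq g
  have hfr := isom_mul_frame g hc hd hcd
  have hval : ∀ y, form (act g (frame u v *ᵥ y)) (frame u v *ᵥ y) =
      form u v * ((c + d) * (y 0 * y 1)) -
        form u v ^ 2 * (((g : GL (Fin 3) ℝ) : Matrix (Fin 3) (Fin 3) ℝ).det * y 2 ^ 2) := by
    intro y
    rw [act, mulVec_mulVec, hfr, ← mulVec_mulVec, form_frame hu hv]
    simp [mulVec_diagonal]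
    ring
  generalize ((g : GL (Fin 3) ℝ) : Matrix (Fin 3) (Fin 3) ℝ).det = e at he hval
  have he1 : e ≤ 1 := by nlinarith
  -- with `y₀ y₁ = (1 + F² y₂²) / (2 F)`, the value is least where `y₂ = 0`, as `e ≤ 1`
  have hlow : ∀ x ∈ Space 2, (c + d) / 2 ≤ form (act g x) x := by
    intro x hx
    have hu' : IsUnit (frame u v).det := by
      rw [det_frame hu hv]
      exact (neg_ne_zero.mpr (pow_ne_zero 2 hF.ne')).isUnit
    obtain ⟨y, rfl⟩ : ∃ y, x = frame u v *ᵥ y :=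
      ⟨(frame u v)⁻¹ *ᵥ x, by rw [mulVec_mulVec, mul_nonsing_inv _ hu', one_mulVec]⟩
    have h1 := hx.1
    rw [form_frame hu hv] at h1
    rw [hval]
    have h2 : 0 ≤ form u v ^ 2 * y 2 ^ 2 * ((c + d) / 2 - e) :=
      mul_nonneg (by positivity) (by linarith)
    nlinarith
  have hlow' : ∀ x : Space 2, Real.arcosh ((c + d) / 2) ≤ hdist (act g x) x := fun x =>
    (Real.arcosh_le_arcosh (by linarith) (by linarith [hlow x x.2])).mpr (hlow x x.2)
  obtain ⟨s, hs, hs2⟩ : ∃ s : ℝ, 0 < s ∧ s ^ 2 = 2 * form u v :=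
    ⟨√(2 * form u v), Real.sqrt_pos.mpr (by linarith), Real.sq_sqrt (by linarith)⟩
  have hmem : frame u v *ᵥ ![1 / s, 1 / s, 0] ∈ Space 2 := by
    constructor
    · rw [form_frame hu hv]
      simp
      field_simp
      linarith
    · rw [frame_mulVec]
      have := hu.2
      have := hv.2
      simp [*]
  have : Nonempty (Space 2) := ⟨⟨_, hmem⟩⟩
  apply le_antisymm
  · refine (ciInf_le ⟨_, Set.forall_mem_range.mpr hlow'⟩ ⟨_, hmem⟩).trans (le_of_eq ?_)
    rw [hdist, hval]
    congr 1
    simp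
    field_simp
    linear_combination -hs2
  · exact le_ciInf hlow'

/-- The traces of the powers of a loxodromic isometry, in terms of its translation length. The
determinant is `-1` for a glide reflection. -/
theorem trace_pow_of_isLoxodromic {g : Isom 2} (hg : IsLoxodromic g) (k : ℕ) :
    (((g : GL (Fin 3) ℝ) : Matrix (Fin 3) (Fin 3) ℝ) ^ k).trace =
      Real.exp (translationLength g) ^ k + (Real.exp (translationLength g))⁻¹ ^ k +
        ((g : GL (Fin 3) ℝ) : Matrix (Fin 3) (Fin 3) ℝ).det ^ k := by
  obtain ⟨u, v, huv, hset⟩ := Set.ncard_eq_two.mp hg.2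
  obtain ⟨hu, c, hc⟩ : u ∈ Boundary 2 ∧ ∃ c : ℝ, act g u = c • u := by
    have : u ∈ ({u, v} : Set (Fin 3 → ℝ)) := by simp
    rwa [← hset] at this
  obtain ⟨hv, d, hd⟩ : v ∈ Boundary 2 ∧ ∃ c : ℝ, act g v = c • v := by
    have : v ∈ ({u, v} : Set (Fin 3 → ℝ)) := by simp
    rwa [← hset] at this
  have hF := form_pos hu hv huv
  have hcd : c * d = 1 := by
    have h := form_act g u v
    rw [hc, hd] at h
    apply mul_right_cancel₀ hF.ne'
    simp only [form_two, Pi.smul_apply, smul_eq_mul] at h ⊢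
    linear_combination h
  have hc0 := pos_of_act_eq_smul hu hc
  have hd0 := pos_of_act_eq_smul hv hd
  have htr : (((g : GL (Fin 3) ℝ) : Matrix (Fin 3) (Fin 3) ℝ) ^ k).trace =
      c ^ k + d ^ k + ((g : GL (Fin 3) ℝ) : Matrix (Fin 3) (Fin 3) ℝ).det ^ k := by
    have hfr := isom_mul_frame g hc hd hcd
    have hu' : IsUnit (frame u v).det := by
      rw [det_frame hu hv]
      exact (neg_ne_zero.mpr (pow_ne_zero 2 hF.ne')).isUnit
    generalize ((g : GL (Fin 3) ℝ) : Matrix (Fin 3) (Fin 3) ℝ) = A at hfr ⊢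
    have hpow : A ^ k * frame u v = frame u v * diagonal ![c, d, A.det] ^ k := by
      have h : SemiconjBy (frame u v) (diagonal ![c, d, A.det]) A := hfr.symm
      exact (h.pow_right k).symm
    have hA : A ^ k = frame u v * diagonal ![c, d, A.det] ^ k * (frame u v)⁻¹ := by
      rw [← hpow, Matrix.mul_assoc, mul_nonsing_inv _ hu', Matrix.mul_one]
    rw [hA, trace_mul_comm, ← Matrix.mul_assoc, nonsing_inv_mul _ hu', Matrix.one_mul,
      diagonal_pow, trace_diagonal]
    simp [Fin.sum_univ_three]
  have hx : Real.exp (translationLength g) + (Real.exp (translationLength g))⁻¹ = c + d := by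
    have hcd2 : 1 ≤ (c + d) / 2 := by nlinarith [sq_nonneg (c - d)]
    have h := Real.cosh_arcosh hcd2
    rw [translationLength_eq hu hv huv hc hd hcd, ← Real.exp_neg]
    rw [Real.cosh_eq] at h
    linarith
  rw [htr]
  have hx0 := Real.exp_pos (translationLength g)
  generalize Real.exp (translationLength g) = x at hx hx0 ⊢
  -- `{x, x⁻¹} = {c, d}`, since both pairs have the same sum and product `1`
  have hd' : d = c⁻¹ := eq_inv_of_mul_eq_one_right hcd
  have hxx : x * x⁻¹ = 1 := mul_inv_cancel₀ hx0.ne'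
  have h0 : (x - c) * (x - d) = 0 := by linear_combination x * hx - hxx + hcd
  rcases mul_eq_zero.mp h0 with h | h
  · rw [hd', sub_eq_zero.mp h]
  · rw [sub_eq_zero.mp h, hd', inv_inv, add_comm (c ^ k)]

end Hyperbolic

/-! ### Quadratic units, and integral rotations -/

theorem ne_zero_of_sq_sub_mul_add_one {a : ℤ} (ha : 3 ≤ a) (r : ℚ) : r ^ 2 - a * r + 1 ≠ 0 := by
  intro h
  have hint : IsIntegral ℤ r := by
    refine ⟨Polynomial.X ^ 2 - Polynomial.C a * Polynomial.X + 1, by monicity!, ?_⟩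
    simp only [Polynomial.eval₂_add, Polynomial.eval₂_sub, Polynomial.eval₂_mul,
      Polynomial.eval₂_pow, Polynomial.eval₂_X, Polynomial.eval₂_C, Polynomial.eval₂_one]
    simpa using h
  obtain ⟨n, rfl⟩ := IsIntegrallyClosed.isIntegral_iff.mp hint
  have h' : n * (a - n) = 1 := by
    have : (n : ℚ) ^ 2 - a * n + 1 = 0 := by simpa using h
    have : n ^ 2 - a * n + 1 = 0 := by exact_mod_cast this
    linear_combination -this
  rcases Int.eq_one_or_neg_one_of_mul_eq_one h' with rfl | rfl <;> omega

theorem minpoly_of_add_inv {a : ℤ} (ha : 3 ≤ a) {x : ℝ} (hx : 1 < x) (h : x + x⁻¹ = a) :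
    minpoly ℚ x = Polynomial.X ^ 2 - Polynomial.C (a : ℚ) * Polynomial.X + 1 := by
  have hxx : x * x⁻¹ = 1 := mul_inv_cancel₀ (by linarith)
  have hm : (Polynomial.X ^ 2 - Polynomial.C (a : ℚ) * Polynomial.X + 1).Monic := by monicity!
  have hdeg : (Polynomial.X ^ 2 - Polynomial.C (a : ℚ) * Polynomial.X + 1).natDegree = 2 := by
    compute_degree!
  have hirr : Irreducible (Polynomial.X ^ 2 - Polynomial.C (a : ℚ) * Polynomial.X + 1) := by
    rw [hm.irreducible_iff_roots_eq_zero_of_degree_le_three (by omega) (by omega)]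
    refine Multiset.eq_zero_of_forall_notMem fun r hr => ?_
    have := (Polynomial.mem_roots'.mp hr).2
    exact ne_zero_of_sq_sub_mul_add_one ha r (by simpa [Polynomial.IsRoot] using this)
  refine (minpoly.eq_of_irreducible_of_monic hirr ?_ hm).symm
  simp only [map_add, map_sub, map_mul, map_pow, Polynomial.aeval_X, map_one,
    map_intCast]
  linear_combination x * h - hxx

/-- The Salem numbers of degree two include the units `x > 1` with `x + x⁻¹` an integer. -/
theorem isSalem_of_add_inv {a : ℤ} (ha : 3 ≤ a) {x : ℝ} (hx : 1 < x) (h : x + x⁻¹ = a) :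
    IsSalem x ∧ (minpoly ℚ x).natDegree = 2 := by
  have hxx : x * x⁻¹ = 1 := mul_inv_cancel₀ (by linarith)
  have hmin := minpoly_of_add_inv ha hx h
  refine ⟨⟨?_, hx, ?_⟩, ?_⟩
  · refine ⟨Polynomial.X ^ 2 - Polynomial.C a * Polynomial.X + 1, by monicity!, ?_⟩
    simp only [Polynomial.eval₂_add, Polynomial.eval₂_sub, Polynomial.eval₂_mul,
      Polynomial.eval₂_pow, Polynomial.eval₂_X, Polynomial.eval₂_C, Polynomial.eval₂_one]
    simp
    linear_combination x * h - hxx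
  · rw [hmin]
    have hC : (x : ℂ) + (x : ℂ)⁻¹ = a := by exact_mod_cast congrArg (fun y : ℝ => (y : ℂ)) h
    have hCC : (x : ℂ) * (x : ℂ)⁻¹ = 1 := by exact_mod_cast congrArg (fun y : ℝ => (y : ℂ)) hxx
    have hfac : ∀ z : ℂ, z ^ 2 - a * z + 1 = (z - x) * (z - (x : ℂ)⁻¹) := fun z => by
      linear_combination z * hC - hCC
    have h1 : ‖(x : ℂ)‖ = x := by
      rw [Complex.norm_real, Real.norm_of_nonneg (by linarith)]
    ext z
    simp only [Set.mem_ofPred_eq, map_add, map_sub, map_mul, map_pow, Polynomial.aeval_X, map_one,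
      map_intCast, Set.mem_insert_iff, Set.mem_singleton_iff, hfac,
      mul_eq_zero, sub_eq_zero]
    constructor
    · exact fun hz => hz.1
    · rintro (rfl | rfl)
      · exact ⟨Or.inl rfl, by rw [h1]; exact hx.ne'⟩
      · exact ⟨Or.inr rfl, by rw [norm_inv, h1]; exact (inv_lt_one_of_one_lt₀ hx).ne⟩
  · rw [hmin]
    compute_degree!

theorem exists_add_inv_eq {a : ℤ} (ha : 3 ≤ a) : ∃ x : ℝ, 1 < x ∧ x + x⁻¹ = a := by
  have ha' : (3 : ℝ) ≤ a := by exact_mod_cast ha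
  have hs : √((a : ℝ) ^ 2 - 4) ^ 2 = (a : ℝ) ^ 2 - 4 := Real.sq_sqrt (by nlinarith)
  have hs0 := Real.sqrt_nonneg ((a : ℝ) ^ 2 - 4)
  have hx : 1 < ((a : ℝ) + √((a : ℝ) ^ 2 - 4)) / 2 := by linarith
  refine ⟨_, hx, ?_⟩
  field_simp
  linear_combination hs

/-- The traces and the discriminants of the powers of a quadratic unit: the discriminant changes by
a square only. -/
theorem exists_pow_add_inv_pow {a : ℤ} {x : ℝ} (hx : 1 < x) (h : x + x⁻¹ = a) {k : ℕ}
    (hk : 0 < k) : ∃ t r : ℤ, r ≠ 0 ∧ 2 < t ∧ x ^ k + x⁻¹ ^ k = t ∧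
      t ^ 2 - 4 = (a ^ 2 - 4) * r ^ 2 := by
  have hx0 : x ≠ 0 := by linarith
  have hxx : x * x⁻¹ = 1 := mul_inv_cancel₀ hx0
  have key : ∀ k : ℕ,
      (∃ t r : ℤ, x ^ k + x⁻¹ ^ k = t ∧ x ^ k - x⁻¹ ^ k = r * (x - x⁻¹)) ∧
      ∃ t r : ℤ, x ^ (k + 1) + x⁻¹ ^ (k + 1) = t ∧ x ^ (k + 1) - x⁻¹ ^ (k + 1) = r * (x - x⁻¹) := by
    intro k
    induction k with
    | zero => exact ⟨⟨2, 0, by norm_num, by norm_num⟩, ⟨a, 1, by simpa using h, by simp⟩⟩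
    | succ k ih =>
      refine ⟨ih.2, ?_⟩
      obtain ⟨⟨t, r, h1, h2⟩, t', r', h3, h4⟩ := ih
      refine ⟨a * t' - t, a * r' - r, ?_, ?_⟩
      · push_cast
        linear_combination a * h3 - h1 + (x ^ (k + 1) + x⁻¹ ^ (k + 1)) * h -
          (x ^ k + x⁻¹ ^ k) * hxx
      · push_cast
        linear_combination a * h4 - h2 + (x ^ (k + 1) - x⁻¹ ^ (k + 1)) * h -
          (x ^ k - x⁻¹ ^ k) * hxx
  obtain ⟨t, r, h1, h2⟩ := (key k).1
  have hlt : 1 < x ^ k := one_lt_pow₀ hx hk.ne'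
  have hprod : x ^ k * x⁻¹ ^ k = 1 := by rw [← mul_pow, hxx, one_pow]
  have hpos : 0 < x⁻¹ ^ k := by positivity
  refine ⟨t, r, ?_, ?_, h1, ?_⟩
  · rintro rfl
    simp only [Int.cast_zero, zero_mul] at h2
    nlinarith
  · have : (2 : ℝ) < t := by
      rw [← h1]
      have : 0 < (x ^ k - 1) ^ 2 := pow_pos (by linarith) 2
      nlinarith
    exact_mod_cast this
  · have : (t : ℝ) ^ 2 - 4 = ((a : ℝ) ^ 2 - 4) * r ^ 2 := by
      rw [← h1, ← h]
      linear_combination (x ^ k - x⁻¹ ^ k + r * (x - x⁻¹)) * h2 + 4 * hprod - 4 * r ^ 2 * hxx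
    exact_mod_cast this

namespace Ternary

open Matrix

/-- The version of `sq_dvd_of_dvd` for the rational matrix `D⁻¹ B` with `p ∤ D`, obtained by
regarding it as a matrix over the `p`-adic integers. -/
theorem int_sq_dvd_of_dvd {S B : Matrix (Fin 3) (Fin 3) ℤ} {D a : ℤ} {p : ℕ} (hp : p.Prime)
    (hsymm : S.IsSymm) (hB : Bᵀ * S * B = D ^ 2 • S) (hd : B.det = D ^ 3)
    (ht : B.trace = D * (a + 1)) (hpD : ¬ (p : ℤ) ∣ D) (hpS : ¬ (p : ℤ) ∣ S.det)
    (hp2 : ¬ (p : ℤ) ∣ 2) (hpa : (p : ℤ) ∣ a + 2) : (p : ℤ) ^ 2 ∣ a + 2 := by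
  have := Fact.mk hp
  have hdvd : ∀ z : ℤ, (p : ℤ_[p]) ∣ (z : ℤ_[p]) ↔ (p : ℤ) ∣ z := fun z => by
    have := PadicInt.pow_p_dvd_int_iff (p := p) 1 z
    simpa using this
  have hu : IsUnit (D : ℤ_[p]) := by
    by_contra hn
    rw [PadicInt.not_isUnit_iff, PadicInt.norm_int_lt_one_iff_dvd] at hn
    exact hpD hn
  obtain ⟨u, hu⟩ := hu
  let f := Int.castRingHom ℤ_[p]
  have hfD : (↑u⁻¹ : ℤ_[p]) * (D : ℤ_[p]) = 1 := by rw [← hu, Units.inv_mul]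
  have hB' : (B.map f)ᵀ * S.map f * B.map f = (D : ℤ_[p]) ^ 2 • S.map f := by
    rw [← transpose_map, ← Matrix.map_mul, ← Matrix.map_mul, hB]
    ext i j
    rw [map_apply, Matrix.smul_apply, Matrix.smul_apply, smul_eq_mul, map_mul]
    simp [f]
  have hd' : (B.map f).det = (D : ℤ_[p]) ^ 3 := by
    have := congrArg f hd
    rw [RingHom.map_det] at this
    simpa [f] using this
  have ht' : (B.map f).trace = D * ((a : ℤ_[p]) + 1) := by
    have := congrArg f ht
    rw [AddMonoidHom.map_trace f B] at this
    simpa [f] using this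
  have hS' : (S.map f).det = (S.det : ℤ_[p]) := by
    have := RingHom.map_det f S
    simpa [f] using this.symm
  have main := sq_dvd_of_dvd (p := (p : ℤ_[p])) (a := (a : ℤ_[p])) (S := S.map f)
    (A := (↑u⁻¹ : ℤ_[p]) • B.map f) PadicInt.prime_p ?_ (hsymm.map f) ?_ ?_ ?_ ?_ ?_
  · have h := (PadicInt.pow_p_dvd_int_iff (p := p) 2 (a + 2)).mp (by simpa using main)
    simpa using h
  · rw [transpose_smul, smul_mul_assoc, smul_mul_assoc, mul_smul_comm, hB', smul_smul, smul_smul,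
      show (↑u⁻¹ : ℤ_[p]) * ↑u⁻¹ * (D : ℤ_[p]) ^ 2 = 1 by
        linear_combination (↑u⁻¹ * (D : ℤ_[p]) + 1) * hfD, one_smul]
  · rw [det_smul, hd', Fintype.card_fin, ← mul_pow, hfD, one_pow]
  · rw [hS', hdvd]; exact hpS
  · exact_mod_cast (hdvd 2).not.mpr hp2
  · rw [trace_smul, ht', smul_eq_mul, ← mul_assoc, hfD, one_mul]
  · exact_mod_cast (hdvd (a + 2)).mpr hpa

/-- An integer `a` such that `a + 2` and `a - 2` are each divisible exactly once by some prime
greater than `n`. The witness is congruent to `p - 2` modulo `p²` and to `q + 2` modulo `q²`, and it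
is shifted by `3 p² q²` to make it at least `3`. -/
theorem exists_exactly_divisible (n : ℕ) : ∃ (a : ℤ) (p q : ℕ), 3 ≤ a ∧ p.Prime ∧ q.Prime ∧ n < p ∧
    n < q ∧ (p : ℤ) ∣ a + 2 ∧ ¬ (p : ℤ) ^ 2 ∣ a + 2 ∧ (q : ℤ) ∣ a - 2 ∧ ¬ (q : ℤ) ^ 2 ∣ a - 2 := by
  obtain ⟨p, hp, hpp⟩ := Nat.exists_infinite_primes (n + 3)
  obtain ⟨q, hq, hqq⟩ := Nat.exists_infinite_primes (p + 1)
  have hcop : Nat.Coprime (p ^ 2) (q ^ 2) :=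
    Nat.Coprime.pow 2 2 ((Nat.coprime_primes hpp hqq).mpr (by omega))
  obtain ⟨k, hk1, hk2⟩ := Nat.chineseRemainder hcop (p - 2) (q + 2)
  obtain ⟨c, hc⟩ := (Nat.modEq_iff_dvd.mp hk1)
  obtain ⟨d, hd⟩ := (Nat.modEq_iff_dvd.mp hk2)
  rw [Nat.cast_sub (by omega)] at hc
  push_cast at hc hd
  have hp0 : (p : ℤ) ≠ 0 := by exact_mod_cast hpp.ne_zero
  have hq0 : (q : ℤ) ≠ 0 := by exact_mod_cast hqq.ne_zero
  have hp1 : ¬ (p : ℤ) ^ 2 ∣ p := by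
    rintro ⟨e, he⟩
    have : (p : ℤ) ∣ 1 := ⟨e, mul_left_cancel₀ hp0 (by linear_combination he)⟩
    exact hpp.one_lt.ne' (by exact_mod_cast Int.eq_one_of_dvd_one (by positivity) this)
  have hq1 : ¬ (q : ℤ) ^ 2 ∣ q := by
    rintro ⟨e, he⟩
    have : (q : ℤ) ∣ 1 := ⟨e, mul_left_cancel₀ hq0 (by linear_combination he)⟩
    exact hqq.one_lt.ne' (by exact_mod_cast Int.eq_one_of_dvd_one (by positivity) this)
  have e1 : (k : ℤ) + 3 * p ^ 2 * q ^ 2 + 2 = p + p ^ 2 * (3 * q ^ 2 - c) := by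
    linear_combination -hc
  have e2 : (k : ℤ) + 3 * p ^ 2 * q ^ 2 - 2 = q + q ^ 2 * (3 * p ^ 2 - d) := by
    linear_combination -hd
  refine ⟨k + 3 * p ^ 2 * q ^ 2, p, q, ?_, hpp, hqq, by omega, by omega, ?_, ?_, ?_, ?_⟩
  · have h1 : (1 : ℤ) ≤ p ^ 2 * q ^ 2 := by
      have := hpp.pos
      have := hqq.pos
      have : 0 < (p : ℤ) ^ 2 * q ^ 2 := by positivity
      omega
    have h2 : (0 : ℤ) ≤ k := by positivity
    linarith
  · rw [e1]; exact dvd_add (dvd_refl _) (Dvd.dvd.mul_right (dvd_pow_self _ two_ne_zero) _)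
  · rw [e1, dvd_add_left (dvd_mul_right _ _)]; exact hp1
  · rw [e2]; exact dvd_add (dvd_refl _) (Dvd.dvd.mul_right (dvd_pow_self _ two_ne_zero) _)
  · rw [e2, dvd_add_left (dvd_mul_right _ _)]; exact hq1

/-- Two integral rotations whose discriminants are in the square classes of `3 ^ 2 - 4 = 5` and
`4 ^ 2 - 4 = 12` have axes which, together with the image of the second axis under the first
rotation, span the space. -/
theorem axis_triple_ne_zero {S A₁ A₂ : Matrix (Fin 3) (Fin 3) ℤ} (hsymm : S.IsSymm)
    (hS : S.det ≠ 0) (h₁ : A₁ᵀ * S * A₁ = S) (h₂ : A₂ᵀ * S * A₂ = S) (hd₁ : A₁.det = 1)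
    (hd₂ : A₂.det = 1) {t₁ t₂ r₁ r₂ : ℤ} (ht₁ : A₁.trace = t₁ + 1) (ht₂ : A₂.trace = t₂ + 1)
    (hr₁ : r₁ ≠ 0) (hr₂ : r₂ ≠ 0) (e₁ : t₁ ^ 2 - 4 = (3 ^ 2 - 4) * r₁ ^ 2)
    (e₂ : t₂ ^ 2 - 4 = (4 ^ 2 - 4) * r₂ ^ 2) :
    (A₁ *ᵥ axis S A₂) ⬝ᵥ (skew (axis S A₁) *ᵥ axis S A₂) ≠ 0 := by
  intro h0
  have h := two_mul_det_mul_axis_triple h₁ hsymm hd₁ hS two_ne_zero ht₁ (axis S A₂)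
  rw [h0, mul_zero, axis_dotProduct h₁ hsymm hd₁ hS two_ne_zero ht₁,
    axis_dotProduct h₂ hsymm hd₂ hS two_ne_zero ht₂] at h
  generalize axis S A₁ ⬝ᵥ (S *ᵥ axis S A₂) = m at h
  -- if the triple product vanishes, then `q(b₁) q(b₂)` is a square, and so `5 * 12 = 4 * 15` is one
  have hm : m ^ 2 = 15 * (2 * S.det * r₁ * r₂) ^ 2 := by
    linear_combination h + S.det ^ 2 * (t₂ ^ 2 - 4) * e₁ + S.det ^ 2 * 5 * r₁ ^ 2 * e₂
  have hne : 2 * S.det * r₁ * r₂ ≠ 0 := by positivity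
  generalize 2 * S.det * r₁ * r₂ = w at hm hne
  have hdiv : w ∣ m := by
    rw [← Int.pow_dvd_pow_iff two_ne_zero, hm]
    exact dvd_mul_left _ _
  obtain ⟨c, rfl⟩ := hdiv
  have hc : c ^ 2 = 15 := by
    apply mul_left_cancel₀ (pow_ne_zero 2 hne)
    linear_combination hm
  have hc1 : c < 4 := by nlinarith
  have hc2 : -4 < c := by nlinarith
  interval_cases c <;> omega

end Ternary

/-! ### Groups of isometries with an integral normal subgroup -/

namespace Ternary

open Matrix

section Representation

variable {G : Type*} [Group G] {ρ : G →* Matrix (Fin 3) (Fin 3) ℝ}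
  {S : Matrix (Fin 3) (Fin 3) ℤ} {N : Subgroup G}

local notation "toReal" => Int.castRingHom ℝ

theorem det_map_ne_zero (hS : S.det ≠ 0) : (S.map toReal).det ≠ 0 := by
  have h := RingHom.map_det toReal S
  rw [RingHom.mapMatrix_apply] at h
  rw [← h, eq_intCast]
  exact_mod_cast hS

theorem det_sq_eq_one (hS : S.det ≠ 0)
    (hρ : ∀ g, (ρ g)ᵀ * S.map toReal * ρ g = S.map toReal) (g : G) : (ρ g).det ^ 2 = 1 := by
  have h := congrArg det (hρ g)
  rw [det_mul, det_mul, det_transpose] at h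
  apply mul_right_cancel₀ (det_map_ne_zero hS)
  linear_combination h

theorem map_mul_map_inv (g : G) : ρ g * ρ g⁻¹ = 1 := by rw [← map_mul, mul_inv_cancel, map_one]

theorem axis_conj (hS : S.det ≠ 0) (hρ : ∀ g, (ρ g)ᵀ * S.map toReal * ρ g = S.map toReal)
    (g h : G) : axis (S.map toReal) (ρ (g * h * g⁻¹)) =
      (ρ g).det • (ρ g *ᵥ axis (S.map toReal) (ρ h)) := by
  rw [← det_smul_axis_conj (ρ h) (hρ g) (map_mul_map_inv g), smul_smul, ← sq,
    det_sq_eq_one hS hρ, one_smul, map_mul, map_mul]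

theorem transpose_mul_mul_of_map (hρ : ∀ g, (ρ g)ᵀ * S.map toReal * ρ g = S.map toReal) {h : G}
    {A : Matrix (Fin 3) (Fin 3) ℤ} (hA : ρ h = A.map toReal) : Aᵀ * S * A = S := by
  have h1 := hρ h
  rw [hA, ← transpose_map, ← Matrix.map_mul, ← Matrix.map_mul] at h1
  exact Matrix.map_injective (RingHom.injective_int toReal) h1

/-- If a normal subgroup `N` consists of integral matrices, then `G` permutes the axes of its
elements, up to sign, and so it preserves the lattice which they generate. The denominators of
the elements of `G` are therefore bounded by the index `D` of this lattice. -/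
theorem exists_denominator [N.Normal] (hS : S.det ≠ 0)
    (hρ : ∀ g, (ρ g)ᵀ * S.map toReal * ρ g = S.map toReal)
    (hint : ∀ h ∈ N, ∃ A : Matrix (Fin 3) (Fin 3) ℤ, A.det = 1 ∧ ρ h = A.map toReal)
    {h₁ h₂ : G} (hN₁ : h₁ ∈ N) (hN₂ : h₂ ∈ N) {A₁ A₂ : Matrix (Fin 3) (Fin 3) ℤ}
    (hA₁ : ρ h₁ = A₁.map toReal) (hd₁ : A₁.det = 1) (hA₂ : ρ h₂ = A₂.map toReal)
    (hne : (A₁ *ᵥ axis S A₂) ⬝ᵥ (skew (axis S A₁) *ᵥ axis S A₂) ≠ 0) :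
    ∃ D : ℤ, D ≠ 0 ∧ ∀ g, ∃ B : Matrix (Fin 3) (Fin 3) ℤ,
      B.map toReal = ((D : ℝ) * (ρ g).det) • ρ g := by
  have hkey : ∀ h ∈ N, ∀ g, ∃ c : Fin 3 → ℤ,
      (ρ g).det • (ρ g *ᵥ axis (S.map toReal) (ρ h)) = toReal ∘ c := by
    intro h hh g
    obtain ⟨C, -, hC⟩ := hint _ (Subgroup.Normal.conj_mem ‹N.Normal› h hh g)
    exact ⟨axis S C, by rw [← axis_conj hS hρ, hC, map_axis]⟩
  -- three axes of elements of `N`: the third element is `h₁ h₂ h₁⁻¹`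
  let cols : Fin 3 → Fin 3 → ℤ := ![axis S A₁, axis S A₂, A₁ *ᵥ axis S A₂]
  have hcols : ∀ j, ∃ h ∈ N, axis (S.map toReal) (ρ h) = toReal ∘ cols j := by
    intro j
    fin_cases j
    · exact ⟨h₁, hN₁, by rw [hA₁, map_axis]; rfl⟩
    · exact ⟨h₂, hN₂, by rw [hA₂, map_axis]; rfl⟩
    · refine ⟨h₁ * h₂ * h₁⁻¹, Subgroup.Normal.conj_mem ‹N.Normal› h₂ hN₂ h₁, ?_⟩
      have hdet : (ρ h₁).det = 1 := by
        have h := RingHom.map_det toReal A₁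
        rw [RingHom.mapMatrix_apply, hd₁, map_one] at h
        rw [hA₁, ← h]
      rw [axis_conj hS hρ, hdet, one_smul, hA₁, hA₂, map_axis]
      ext i
      exact (RingHom.map_mulVec toReal A₁ (axis S A₂) i).symm
  let P : Matrix (Fin 3) (Fin 3) ℤ := Matrix.of fun i j => cols j i
  have hP : P.det = (A₁ *ᵥ axis S A₂) ⬝ᵥ (skew (axis S A₁) *ᵥ axis S A₂) := by
    simp only [P, cols, det_fin_three, skew]
    generalize A₁ *ᵥ axis S A₂ = w
    simp [dotProduct, mulVec, Fin.sum_univ_three]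
    ring
  refine ⟨P.det, hP ▸ hne, fun g => ?_⟩
  have hc : ∀ j, ∃ c : Fin 3 → ℤ, (ρ g).det • (ρ g *ᵥ (toReal ∘ cols j)) = toReal ∘ c := by
    intro j
    obtain ⟨h, hh, he⟩ := hcols j
    rw [← he]
    exact hkey h hh g
  choose c hc using hc
  have hmul : ((ρ g).det • ρ g) * P.map toReal = (Matrix.of fun i j => c j i).map toReal := by
    ext i j
    rw [smul_mul_assoc]
    exact congrFun (hc j) i
  refine ⟨(Matrix.of fun i j => c j i) * P.adjugate, ?_⟩
  have hadj : P.map toReal * P.adjugate.map toReal = (P.det : ℝ) • 1 := by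
    rw [← Matrix.map_mul, mul_adjugate]
    ext i j
    rw [map_apply, Matrix.smul_apply, Matrix.smul_apply, smul_eq_mul, map_mul]
    rcases eq_or_ne i j with rfl | hij
    · simp
    · simp [hij]
  rw [Matrix.map_mul, ← hmul, Matrix.mul_assoc, hadj, mul_smul_comm, Matrix.mul_one, smul_smul]

/-- A group of isometries of an integral ternary form which has a normal subgroup of integral
rotations containing a power of every element cannot realize all the quadratic units
`x > 1` with `x + x⁻¹` an integer. -/
theorem not_forall_exists_trace_eq [N.Normal] (hsymm : S.IsSymm) (hS : S.det ≠ 0)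
    (hρ : ∀ g, (ρ g)ᵀ * S.map toReal * ρ g = S.map toReal)
    (hint : ∀ h ∈ N, ∃ A : Matrix (Fin 3) (Fin 3) ℤ, A.det = 1 ∧ ρ h = A.map toReal)
    (hpow : ∀ g, ∃ k, 0 < k ∧ g ^ k ∈ N) :
    ¬ ∀ (a : ℤ) (x : ℝ), 3 ≤ a → 1 < x → x + x⁻¹ = a →
      ∃ g, ∀ k, (ρ g ^ k).trace = x ^ k + x⁻¹ ^ k + (ρ g).det ^ k := by
  intro hall
  have hmap_det : ∀ A : Matrix (Fin 3) (Fin 3) ℤ, (A.map toReal).det = A.det := by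
    intro A
    have h := RingHom.map_det toReal A
    rw [RingHom.mapMatrix_apply] at h
    rw [← h, eq_intCast]
  have hmap_trace : ∀ A : Matrix (Fin 3) (Fin 3) ℤ, (A.map toReal).trace = A.trace := by
    intro A
    simp [trace_fin_three]
  -- a power of the element realizing `a` lies in `N`, with discriminant `a² - 4` up to squares
  have hex : ∀ a : ℤ, 3 ≤ a → ∃ h ∈ N, ∃ A : Matrix (Fin 3) (Fin 3) ℤ, ∃ t r : ℤ,
      A.det = 1 ∧ ρ h = A.map toReal ∧ A.trace = t + 1 ∧ r ≠ 0 ∧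
        t ^ 2 - 4 = (a ^ 2 - 4) * r ^ 2 := by
    intro a ha
    obtain ⟨x, hx, hxa⟩ := exists_add_inv_eq ha
    obtain ⟨g, hg⟩ := hall a x ha hx hxa
    obtain ⟨k, hk, hkN⟩ := hpow g
    obtain ⟨A, hA1, hA⟩ := hint _ hkN
    obtain ⟨t, r, hr, -, ht, htr⟩ := exists_pow_add_inv_pow hx hxa hk
    refine ⟨_, hkN, A, t, r, hA1, hA, ?_, hr, htr⟩
    have hdet : (ρ g).det ^ k = 1 := by
      rw [← det_pow, ← map_pow, hA, hmap_det, hA1, Int.cast_one]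
    have htrace := hg k
    rw [hdet, ht, ← map_pow, hA, hmap_trace] at htrace
    exact_mod_cast htrace
  obtain ⟨h₁, hN₁, A₁, t₁, r₁, hd₁, hA₁, ht₁, hr₁, e₁⟩ := hex 3 le_rfl
  obtain ⟨h₂, hN₂, A₂, t₂, r₂, hd₂, hA₂, ht₂, hr₂, e₂⟩ := hex 4 (by norm_num)
  have hne := axis_triple_ne_zero hsymm hS (transpose_mul_mul_of_map hρ hA₁)
    (transpose_mul_mul_of_map hρ hA₂) hd₁ hd₂ ht₁ ht₂ hr₁ hr₂ e₁ e₂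
  obtain ⟨D, hD, hB⟩ := exists_denominator hS hρ hint hN₁ hN₂ hA₁ hd₁ hA₂ hne
  obtain ⟨a, p, q, ha, hp, hq, hnp, hnq, hpa, hpa', hqa, hqa'⟩ :=
    exists_exactly_divisible (2 * D * S.det).natAbs
  have hnot : ∀ (l : ℕ), (2 * D * S.det).natAbs < l → ¬ (l : ℤ) ∣ 2 * D * S.det := by
    intro l hl hdvd
    have h0 : 2 * D * S.det ≠ 0 := by positivity
    have := Nat.le_of_dvd (Int.natAbs_pos.mpr h0) (Int.natCast_dvd.mp hdvd)
    omega
  obtain ⟨x, hx, hxa⟩ := exists_add_inv_eq ha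
  obtain ⟨g, hg⟩ := hall a x ha hx hxa
  obtain ⟨B, hB⟩ := hB g
  have hdet2 := det_sq_eq_one hS hρ g
  have htr := hg 1
  rw [pow_one, pow_one, pow_one, pow_one, hxa] at htr
  have hgS := hρ g
  generalize ρ g = Y at hB hdet2 htr hgS
  have hinj : Function.Injective fun A : Matrix (Fin 3) (Fin 3) ℤ => A.map toReal :=
    Matrix.map_injective (RingHom.injective_int toReal)
  have hBS : Bᵀ * S * B = D ^ 2 • S := by
    apply hinj
    have h1 : (D ^ 2 • S).map toReal = (D : ℝ) ^ 2 • S.map toReal := by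
      ext i j
      rw [map_apply, Matrix.smul_apply, Matrix.smul_apply, smul_eq_mul, map_mul]
      simp
    simp only [Matrix.map_mul, transpose_map, h1, hB, transpose_smul, smul_mul_assoc,
      mul_smul_comm, hgS, smul_smul]
    congr 1
    linear_combination (D : ℝ) ^ 2 * hdet2
  have hBd : B.det = D ^ 3 := by
    have h1 : (B.det : ℝ) = (D : ℝ) ^ 3 := by
      rw [← hmap_det, hB, det_smul, Fintype.card_fin]
      linear_combination (D : ℝ) ^ 3 * (Y.det ^ 2 + 1) * hdet2
    exact_mod_cast h1
  have hsign : ∃ ε : ℤ, (ε = 1 ∨ ε = -1) ∧ Y.det = ε := by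
    rcases eq_or_eq_neg_of_sq_eq_sq Y.det 1 (by rw [hdet2, one_pow]) with h | h
    · exact ⟨1, Or.inl rfl, by rw [h]; simp⟩
    · exact ⟨-1, Or.inr rfl, by rw [h]; simp⟩
  obtain ⟨ε, hε, hYε⟩ := hsign
  have hBt : B.trace = D * (ε * a + 1) := by
    have h1 : (B.trace : ℝ) = (D : ℝ) * (ε * a + 1) := by
      rw [← hmap_trace, hB, trace_smul, htr, smul_eq_mul, ← hYε]
      linear_combination (D : ℝ) * hdet2
    exact_mod_cast h1
  -- the sign of `det Y` decides whether the spinor norm is `a + 2` or `2 - a`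
  rcases hε with rfl | rfl
  · have h := int_sq_dvd_of_dvd hp hsymm hBS hBd hBt
      (fun h => hnot p hnp ((h.mul_left 2).mul_right _)) (fun h => hnot p hnp (h.mul_left _))
      (fun h => hnot p hnp ((h.mul_right D).mul_right _)) (by rwa [one_mul])
    exact hpa' (by rwa [one_mul] at h)
  · have e : -1 * a + 2 = -(a - 2) := by ring
    have h := int_sq_dvd_of_dvd hq hsymm hBS hBd hBt
      (fun h => hnot q hnq ((h.mul_left 2).mul_right _)) (fun h => hnot q hnq (h.mul_left _))
      (fun h => hnot q hnq ((h.mul_right D).mul_right _)) (by rwa [e, dvd_neg])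
    exact hqa' (by rwa [e, dvd_neg] at h)

end Representation

/-- A matrix in the orthogonal group of a definite form is conjugate to an orthogonal matrix, and
so its trace is at most its size. -/
theorem trace_le_of_posDef {n : ℕ} {P A : Matrix (Fin n) (Fin n) ℝ} (hP : P.PosDef)
    (hA : Aᵀ * P * A = P) : A.trace ≤ n := by
  open scoped MatrixOrder in
  obtain ⟨C, hC⟩ := CStarAlgebra.nonneg_iff_eq_star_mul_self.mp hP.posSemidef.nonneg
  rw [star_eq_conjTranspose, conjTranspose_eq_transpose_of_trivial] at hC
  have hCu : IsUnit C.det := by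
    have h := hP.det_pos
    rw [hC, det_mul, det_transpose] at h
    exact (left_ne_zero_of_mul h.ne').isUnit
  have h1 : C⁻¹ * C = 1 := nonsing_inv_mul _ hCu
  have h2 : C * C⁻¹ = 1 := mul_nonsing_inv _ hCu
  have h2t : (C⁻¹)ᵀ * Cᵀ = 1 := by rw [← transpose_mul, h2, transpose_one]
  have hU : C * A * C⁻¹ ∈ Matrix.unitaryGroup (Fin n) ℝ := by
    rw [mem_unitaryGroup_iff', star_eq_conjTranspose, conjTranspose_eq_transpose_of_trivial]
    calc _ = (C⁻¹)ᵀ * (Aᵀ * (Cᵀ * C) * A) * C⁻¹ := by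
            simp only [transpose_mul, Matrix.mul_assoc]
      _ = ((C⁻¹)ᵀ * Cᵀ) * (C * C⁻¹) := by rw [← hC, hA, hC]; simp only [Matrix.mul_assoc]
      _ = 1 := by rw [h2t, h2, Matrix.one_mul]
  have htr : A.trace = (C * A * C⁻¹).trace := by
    rw [trace_mul_comm, ← Matrix.mul_assoc, h1, Matrix.one_mul]
  rw [htr, trace]
  calc _ ≤ ∑ _i : Fin n, (1 : ℝ) := Finset.sum_le_sum fun i _ =>
          (le_abs_self _).trans (entry_norm_bound_of_unitary hU i i)
    _ = n := by simp

end Ternary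

/-! ### Arithmetic groups -/

/-- A totally real field has as many real embeddings as its degree, so it is `ℚ` if it has only
one. -/
theorem algebraMap_rat_surjective_of_unique_embedding {K : Type*} [Field K] [NumberField K]
    [NumberField.IsTotallyReal K] (ι : K →+* ℝ) (h : ∀ σ : K →+* ℝ, σ = ι) :
    Function.Surjective (algebraMap ℚ K) := by
  have hsub : Subsingleton (K →+* ℂ) := by
    have key : ∀ φ : K →+* ℂ, φ = Complex.ofRealHom.comp ι := by
      intro φ
      have hφ := NumberField.IsTotallyReal.complexEmbedding_isReal φ
      rw [← h hφ.embedding]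
      ext x
      exact (hφ.coe_embedding_apply x).symm
    exact ⟨fun φ ψ => (key φ).trans (key ψ).symm⟩
  have hle : Module.finrank ℚ K ≤ 1 := by
    rw [← NumberField.Embeddings.card K ℂ]
    exact Fintype.card_le_one_iff_subsingleton.mpr hsub
  have h1 : Module.finrank ℚ K = 1 := le_antisymm hle Module.finrank_pos
  rw [Algebra.surjective_algebraMap_iff]
  exact (Subalgebra.bot_eq_top_iff_finrank_eq_one.mpr h1).symm

namespace Hyperbolic

open Matrix

section

variable {K : Type*} [Field K] {S : Matrix (Fin 3) (Fin 3) K} {M : GL (Fin 3) ℝ} {ι : K →+* ℝ}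

/-- The representation of a group of isometries on the quadratic space of an arithmetic group:
conjugation by `g`, followed by the change of coordinates `M`. -/
def conjRep (Γ : Subgroup (Isom 2)) (g : Isom 2) (M : GL (Fin 3) ℝ) :
    Γ →* Matrix (Fin 3) (Fin 3) ℝ :=
  (Units.coeHom _).comp ((MulAut.conj M⁻¹).toMonoidHom.comp
    ((Isom 2).subtype.comp ((MulAut.conj g).toMonoidHom.comp Γ.subtype)))

variable {Γ : Subgroup (Isom 2)} {g : Isom 2}

theorem conjRep_eq (γ : Γ) : conjRep Γ g M γ =
    ((M⁻¹ * (g * γ * g⁻¹ : Isom 2) * M : GL (Fin 3) ℝ) : Matrix (Fin 3) (Fin 3) ℝ) := by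
  simp [conjRep]

theorem conjRep_eq_conj (γ : Γ) : conjRep Γ g M γ =
    ((M⁻¹ * g : GL (Fin 3) ℝ) : Matrix (Fin 3) (Fin 3) ℝ) *
      (((γ : Isom 2) : GL (Fin 3) ℝ) : Matrix (Fin 3) (Fin 3) ℝ) *
      (((M⁻¹ * g)⁻¹ : GL (Fin 3) ℝ) : Matrix (Fin 3) (Fin 3) ℝ) := by
  rw [conjRep_eq, ← Units.val_mul, ← Units.val_mul]
  congr 1
  simp only [Subgroup.coe_mul, Subgroup.coe_inv]
  group

theorem det_conjRep (γ : Γ) : (conjRep Γ g M γ).det =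
    (((γ : Isom 2) : GL (Fin 3) ℝ) : Matrix (Fin 3) (Fin 3) ℝ).det := by
  rw [conjRep_eq_conj, det_units_conj]

theorem trace_conjRep_pow (γ : Γ) (k : ℕ) : (conjRep Γ g M γ ^ k).trace =
    ((((γ : Isom 2) : GL (Fin 3) ℝ) : Matrix (Fin 3) (Fin 3) ℝ) ^ k).trace := by
  rw [← map_pow, conjRep_eq_conj, trace_units_conj]
  simp

theorem conjRep_isometry
    (hM : (M : Matrix (Fin 3) (Fin 3) ℝ)ᵀ * J 2 * (M : Matrix (Fin 3) (Fin 3) ℝ) = S.map ι)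
    (γ : Γ) : (conjRep Γ g M γ)ᵀ * S.map ι * conjRep Γ g M γ = S.map ι := by
  rw [conjRep_eq, ← hM, Units.val_mul, Units.val_mul]
  have hX := (g * γ * g⁻¹ : Isom 2).2.1
  have h1 : (M : Matrix (Fin 3) (Fin 3) ℝ) *
      ((M⁻¹ : GL (Fin 3) ℝ) : Matrix (Fin 3) (Fin 3) ℝ) = 1 := by
    rw [← Units.val_mul, mul_inv_cancel, Units.val_one]
  have h1t : ((M⁻¹ : GL (Fin 3) ℝ) : Matrix (Fin 3) (Fin 3) ℝ)ᵀ *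
      (M : Matrix (Fin 3) (Fin 3) ℝ)ᵀ = 1 := by rw [← transpose_mul, h1, transpose_one]
  generalize (((g * γ * g⁻¹ : Isom 2) : GL (Fin 3) ℝ) : Matrix (Fin 3) (Fin 3) ℝ) = X at hX ⊢
  generalize ((M⁻¹ : GL (Fin 3) ℝ) : Matrix (Fin 3) (Fin 3) ℝ) = M' at h1 h1t ⊢
  generalize (M : Matrix (Fin 3) (Fin 3) ℝ) = M₀ at h1 h1t ⊢
  calc _ = M₀ᵀ * (Xᵀ * ((M'ᵀ * M₀ᵀ) * J 2 * (M₀ * M')) * X) * M₀ := by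
          simp only [transpose_mul, Matrix.mul_assoc]
    _ = _ := by rw [h1, h1t, Matrix.one_mul, Matrix.mul_one, hX]

theorem exists_integralSO_of_mem {γ : Γ} (h : g * γ * g⁻¹ ∈ arithmeticGroup ι S M) :
    ∃ A ∈ integralSO S, conjRep Γ g M γ = (A.1.map (algebraMap (𝓞 K) K)).map ι := by
  obtain ⟨A, hA, h⟩ := h
  refine ⟨A, hA, ?_⟩
  rw [conjRep_eq]
  have h' : ((g * γ * g⁻¹ : Isom 2) : GL (Fin 3) ℝ) = M *
    (Matrix.SpecialLinearGroup.toGL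
      (Matrix.SpecialLinearGroup.map (ι.comp (algebraMap (𝓞 K) K)) A)) * M⁻¹ := h.symm
  rw [h']
  have : M⁻¹ * (M * (Matrix.SpecialLinearGroup.toGL
      (Matrix.SpecialLinearGroup.map (ι.comp (algebraMap (𝓞 K) K)) A)) * M⁻¹) * M =
      Matrix.SpecialLinearGroup.toGL
      (Matrix.SpecialLinearGroup.map (ι.comp (algebraMap (𝓞 K) K)) A) := by group
  rw [this]
  ext i j
  simp

/-- The normal core of the arithmetic part of `Γ` is a normal subgroup of finite index. -/
theorem exists_normal_subgroup (h : Subgroup.Commensurable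
    (Γ.map (MulAut.conj g).toMonoidHom) (arithmeticGroup ι S M)) :
    ∃ N : Subgroup Γ, N.Normal ∧ (∀ γ, ∃ k, 0 < k ∧ γ ^ k ∈ N) ∧
      ∀ γ ∈ N, ∃ A ∈ integralSO S,
        conjRep Γ g M γ = (A.1.map (algebraMap (𝓞 K) K)).map ι := by
  let H := ((arithmeticGroup ι S M).comap (MulAut.conj g).toMonoidHom).subgroupOf Γ
  have hH : H.index ≠ 0 := by
    have h2 := h.2
    rw [← Subgroup.relIndex_comap] at h2
    exact h2
  have : H.FiniteIndex := ⟨hH⟩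
  refine ⟨H.normalCore, inferInstance, fun γ => ?_, fun γ hγ => ?_⟩
  · obtain ⟨k, hk, -, hkN⟩ :=
      Subgroup.exists_pow_mem_of_index_ne_zero (H := H.normalCore)
        Subgroup.FiniteIndex.index_ne_zero γ
    exact ⟨k, hk, hkN⟩
  · exact exists_integralSO_of_mem (H.normalCore_le hγ)

/-- If a loxodromic element has rational trace `t + 1 > 3`, then the form cannot be definite at
another real place, where the trace is the same. -/
theorem not_definite_of_trace {A : Matrix.SpecialLinearGroup (Fin 3) (𝓞 K)}
    (hA : A ∈ integralSO S) {t : ℤ} (ht : 2 < t)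
    (htr : ((A.1.map (algebraMap (𝓞 K) K)).map ι).trace = t + 1) (σ : K →+* ℝ) :
    ¬ ((S.map σ).PosDef ∨ (-S.map σ).PosDef) := by
  have hA' : (A.1.map (algebraMap (𝓞 K) K))ᵀ * S * A.1.map (algebraMap (𝓞 K) K) = S := hA
  generalize A.1.map (algebraMap (𝓞 K) K) = B at hA' htr
  have hB : B.trace = t + 1 := by
    apply ι.injective
    rw [AddMonoidHom.map_trace ι B, htr]
    simp
  have hσ : (B.map σ).trace = t + 1 := by
    rw [← AddMonoidHom.map_trace σ B, hB]
    simp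
  have hAσ : (B.map σ)ᵀ * S.map σ * B.map σ = S.map σ := by
    rw [← transpose_map, ← Matrix.map_mul, ← Matrix.map_mul, hA']
  have hlt : (3 : ℝ) < (B.map σ).trace := by
    rw [hσ]
    have : (2 : ℝ) < t := by exact_mod_cast ht
    linarith
  rintro (h | h)
  · exact absurd (Ternary.trace_le_of_posDef h hAσ) (by exact_mod_cast hlt.not_ge)
  · refine absurd (Ternary.trace_le_of_posDef h (A := B.map σ) ?_) (by exact_mod_cast hlt.not_ge)
    rw [Matrix.mul_neg, Matrix.neg_mul, hAσ]

end

end Hyperbolic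

theorem exists_integral_multiple {K : Type*} [Field K] [NumberField K] {ι : K →+* ℝ}
    (hK : Function.Surjective (algebraMap ℚ K)) {S : Matrix (Fin 3) (Fin 3) K} (hS : S.IsSymm)
    (hd : S.det ≠ 0) : ∃ (b : ℝ) (T : Matrix (Fin 3) (Fin 3) ℤ), b ≠ 0 ∧ T.IsSymm ∧ T.det ≠ 0 ∧
      T.map (Int.castRingHom ℝ) = b • S.map ι := by
  choose Q hQ using fun ij : Fin 3 × Fin 3 => hK (S ij.1 ij.2)
  obtain ⟨b, hb⟩ := IsLocalization.exist_integer_multiples_of_finite (nonZeroDivisors ℤ) Q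
  choose T hT using hb
  have hb0 : ((b : ℤ) : ℝ) ≠ 0 := by exact_mod_cast nonZeroDivisors.coe_ne_zero b
  have hmap : (Matrix.of fun i j => T (i, j)).map (Int.castRingHom ℝ) =
      ((b : ℤ) : ℝ) • S.map ι := by
    ext i j
    have h1 : (T (i, j) : ℚ) = (b : ℤ) * Q (i, j) := by simpa using hT (i, j)
    have h2 : ι (S i j) = (Q (i, j) : ℝ) := by
      rw [← hQ (i, j), ← RingHom.comp_apply, eq_ratCast]
    simp only [Matrix.map_apply, Matrix.of_apply, Matrix.smul_apply, smul_eq_mul, h2, eq_intCast]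
    exact_mod_cast congrArg (fun q : ℚ => (q : ℝ)) h1
  refine ⟨(b : ℤ), Matrix.of fun i j => T (i, j), hb0, ?_, ?_, hmap⟩
  · apply Matrix.map_injective (RingHom.injective_int (Int.castRingHom ℝ))
    change (Matrix.of fun i j => T (i, j))ᵀ.map (Int.castRingHom ℝ) = _
    rw [Matrix.transpose_map, hmap, Matrix.transpose_smul, (hS.map ι).eq]
    exact hmap.symm
  · intro h0
    have h1 := congrArg Matrix.det hmap
    have h2 := RingHom.map_det (Int.castRingHom ℝ) (Matrix.of fun i j => T (i, j))
    have h3 := RingHom.map_det ι S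
    rw [RingHom.mapMatrix_apply] at h2 h3
    rw [← h2, h0, map_zero, Matrix.det_smul, ← h3] at h1
    exact mul_ne_zero (pow_ne_zero _ hb0) ((map_ne_zero ι).mpr hd) h1.symm

theorem exists_int_of_ringOfIntegers {K : Type*} [Field K] [NumberField K] (ι : K →+* ℝ)
    (hK : Function.Surjective (algebraMap ℚ K)) (y : 𝓞 K) :
    ∃ n : ℤ, ι (algebraMap (𝓞 K) K y) = n := by
  obtain ⟨q, hq⟩ := hK (algebraMap (𝓞 K) K y)
  have hint : IsIntegral ℤ q := by
    rw [← isIntegral_algebraMap_iff (algebraMap ℚ K).injective, hq]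
    exact y.2
  obtain ⟨n, rfl⟩ := IsIntegrallyClosed.isIntegral_iff.mp hint
  exact ⟨n, by rw [← hq]; simp⟩

end

theorem mainTheorem6 (K : Type*) [Field K] [NumberField K] [NumberField.IsTotallyReal K]
    (ι : K →+* ℝ) (Γ : Subgroup (Hyperbolic.Isom 2)) (hΓ : Hyperbolic.IsArithmetic ι Γ) :
    ¬ ∀ x : ℝ, IsSalem x → (minpoly ℚ x).natDegree = 2 → Hyperbolic.Realizes Γ x := by
  intro hall
  obtain ⟨S, M, ⟨hsymm, -, hdef⟩, hM, g, hcomm⟩ := hΓ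
  obtain ⟨N, hN, hpow, hint⟩ := Hyperbolic.exists_normal_subgroup hcomm
  have hreal : ∀ (a : ℤ) (x : ℝ), 3 ≤ a → 1 < x → x + x⁻¹ = a →
      ∃ γ : Γ, ∀ k, (Hyperbolic.conjRep Γ g M γ ^ k).trace =
        x ^ k + x⁻¹ ^ k + (Hyperbolic.conjRep Γ g M γ).det ^ k := by
    intro a x ha hx hxa
    obtain ⟨hs, hdeg⟩ := isSalem_of_add_inv ha hx hxa
    obtain ⟨γ, hγ, hlox, rfl⟩ := hall x hs hdeg
    refine ⟨⟨γ, hγ⟩, fun k => ?_⟩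
    rw [Hyperbolic.trace_conjRep_pow, Hyperbolic.det_conjRep,
      Hyperbolic.trace_pow_of_isLoxodromic hlox]
  -- definiteness at the other real places leaves only the field of rational numbers
  have hι : ∀ σ : K →+* ℝ, σ = ι := by
    intro σ
    by_contra hσ
    obtain ⟨x, hx, hxa⟩ := exists_add_inv_eq (le_refl 3)
    obtain ⟨γ, hγ⟩ := hreal 3 x le_rfl hx hxa
    obtain ⟨k, hk, hkN⟩ := hpow γ
    obtain ⟨A, hA, hρ⟩ := hint _ hkN
    obtain ⟨t, r, -, ht, htk, -⟩ := exists_pow_add_inv_pow hx hxa hk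
    refine Hyperbolic.not_definite_of_trace hA ht ?_ σ (hdef σ hσ) (ι := ι)
    have hdet : (Hyperbolic.conjRep Γ g M γ).det ^ k = 1 := by
      rw [← Matrix.det_pow, ← map_pow, hρ, Matrix.map_map]
      have h := RingHom.map_det (ι.comp (algebraMap (𝓞 K) K)) A.1
      rw [A.2, map_one] at h
      exact h.symm
    rw [← hρ, map_pow, hγ k, htk, hdet]
  have hK := algebraMap_rat_surjective_of_unique_embedding ι hι
  have hd : S.det ≠ 0 := by
    intro h0
    have h1 := congrArg Matrix.det hM
    have h2 := RingHom.map_det ι S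
    rw [RingHom.mapMatrix_apply, h0, map_zero] at h2
    have hJ : (Hyperbolic.J 2).det = 1 := by simp [Hyperbolic.J, Fin.prod_univ_three]
    rw [← h2, Matrix.det_mul, Matrix.det_mul, Matrix.det_transpose, hJ, mul_one] at h1
    exact M.det.ne_zero (mul_self_eq_zero.mp h1)
  obtain ⟨b, T, hb, hT, hTd, hTS⟩ := exists_integral_multiple (ι := ι) hK hsymm hd
  refine Ternary.not_forall_exists_trace_eq (ρ := Hyperbolic.conjRep Γ g M) (N := N) hT hTd
    (fun γ => ?_) (fun γ hγ => ?_) hpow hreal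
  · rw [hTS, mul_smul_comm, smul_mul_assoc, Hyperbolic.conjRep_isometry hM]
  · obtain ⟨A, -, hρ⟩ := hint γ hγ
    choose n hn using fun i j => exists_int_of_ringOfIntegers ι hK (A.1 i j)
    have hmap : (A.1.map (algebraMap (𝓞 K) K)).map ι =
        (Matrix.of n).map (Int.castRingHom ℝ) := by
      ext i j
      exact hn i j
    refine ⟨Matrix.of n, ?_, hρ.trans hmap⟩
    have h1 := RingHom.map_det (ι.comp (algebraMap (𝓞 K) K)) A.1
    have h2 := RingHom.map_det (Int.castRingHom ℝ) (Matrix.of n)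
    rw [RingHom.mapMatrix_apply] at h1 h2
    rw [A.2, map_one] at h1
    rw [← hmap, Matrix.map_map] at h2
    exact RingHom.injective_int (Int.castRingHom ℝ) (by rw [h2, map_one]; exact h1.symm)
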